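/- Assume the Continuum Hypothesis. Let $l,n\in\omega$ with $l>0$, let $\kappa>\aleph_l$ be a regular cardinal, let $H(\kappa)$ be the set of all sets whose transitive closure has size less than $\kappa$, and let $\trianglelefteq$ be a well-order of $H(\kappa)$. Write $\mathsf{Sub}(\kappa)$ for the collection of all countable $M\subseteq H(\kappa)$ such that $(M,\in,\trianglelefteq)$ is an elementary submodel of $(H(\kappa),\in,\trianglelefteq)$, and put $\delta_M=M\cap\omega_1$ for $M\in\mathsf{Sub}(\kappa)$; this is a countable ordinal. Definitions. A $0$-model is an element of $\mathsf{Sub}(\kappa)$. An $(m+1)$-model is an $N\in\mathsf{Sub}(\kappa)$ for which there are $m$-models $N_\alpha\in N$ $(\alpha<\delta_N)$ such that $N_\alpha\in N_\beta$ whenever $\alpha<\beta<\delta_N$, $N_\alpha=\bigcup_{\xi<\alpha}N_\xi$ for every limit $\alpha<\delta_N$, and $N=\bigcup_{\alpha<\delta_N}N_\alpha$. A sequence $\langle M_0,\dots,M_n\rangle$ of elements of $\mathsf{Sub}(\kappa)$ is $\delta$-increasing if $\delta_{M_i}\le\delta_{M_{i+1}}$ for all $i<n$. A partition is a collection of pairwise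 disjoint sets, of which $\emptyset$ may be one. A decisive partition (of countable subsets of $\omega_l$) for $\langle M_0,\dots,M_n\rangle$ is a sequence $P=\langle P_i\mid i\le n\rangle$ such that for all $i,j\le n$: $P_i\in M_i$, $P_i$ is a finite partition, and each element of $P_i$ is a countable subset of $\omega_l$; and if $i<j$ and $A\in P_i$, then $A\in P_j$ or $A\cap M_j=\emptyset$. For partitions $R,P$, we write $R\preceq_2 P$ ($R$ is a $2$-refinement of $P$) if every element of $R$ is contained in an element of $P$ and every element of $P$ is the union of at most two elements of $R$. Theorem. Let $\langle M_0,\dots,M_n\rangle$ be a $\delta$-increasing sequence, let $P=\langle P_i\mid i\le n\rangle$ be a decisive partition for $\langle M_0,\dots,M_n\rangle$, let $N$ be an $l$-model with $\delta_{M_n}<\delta_N$, and let $X\in N$. Then there are $L\in N$ and $R=\langle R_i\mid i\le n\rangle$ such that: 1. $L\in\mathsf{Sub}(\kappa)$, $\delta_{M_n}<\delta_L$ and $X\in L$; 2. $R$ is a decisive partition (of countable subsets of $\omega_l$) for $\langle M_0,\dots,M_n\rangle$; 3. $R_i\preceq_2 P_i$ for every $i\le n$; 4. every $A\in\bigcup_{i\le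 n}R_i$ satisfies $A\in L$ or $A\cap L=\emptyset$. -/

import Mathlib

universe u

open Cardinal Ordinal

namespace SubmodelComb

/-- `H(κ)`: the sets whose transitive closure has size less than `κ`. The elements of the transitive
closure of `x` are the `y` with `y ∈ ⋯ ∈ x` (in at least one step). -/
def H (κ : Cardinal.{u}) : Set ZFSet.{u} :=
  {x | #{y : ZFSet.{u} // Relation.TransGen (fun a b : ZFSet.{u} => a ∈ b) y x} <
    Cardinal.lift.{u + 1} κ}

/-- The two binary relation symbols of the language of set theory with a well-order. -/
inductive SetWORel : ℕ → Type
  | mem : SetWORel 2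
  | wo : SetWORel 2

/-- The first-order language with two binary relation symbols (membership, well-order). -/
def setWOLanguage : FirstOrder.Language.{0, 0} := ⟨fun _ => Empty, SetWORel⟩

/-- The structure `(H(κ), ∈, r)`, where `r` is a binary relation on `H(κ)`. -/
@[reducible] def structureH (κ : Cardinal.{u}) (r : H κ → H κ → Prop) :
    setWOLanguage.Structure (H κ) where
  funMap := fun f => nomatch f
  RelMap
    | SetWORel.mem => fun x => (x 0).1 ∈ (x 1).1
    | SetWORel.wo => fun x => r (x 0) (x 1)

/-- `M ∈ Sub(κ)`: `M` is a countable subset of `H(κ)` and `(M, ∈, r)` is an elementary submodel of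
`(H(κ), ∈, r)`. -/
def IsSub (κ : Cardinal.{u}) (r : H κ → H κ → Prop) (M : ZFSet.{u}) : Prop :=
  (M : Set ZFSet.{u}).Countable ∧ (M : Set ZFSet.{u}) ⊆ H κ ∧
    letI := structureH κ r
    ∃ S : setWOLanguage.ElementarySubstructure (H κ), ∀ x : H κ, x ∈ S ↔ x.1 ∈ M

/-- The height `δ_M = M ∩ ω₁`. For `M ∈ Sub(κ)` (with `κ > ω₁`) the set `M ∩ ω₁` is a von Neumann
ordinal, and the rank of a von Neumann ordinal is that ordinal. -/
noncomputable def height (M : ZFSet.{u}) : Ordinal.{u} :=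
  (M ∩ (ω_ 1).toZFSet).rank

/-- `(C_α)_{α < δ}` is a continuous increasing chain: `C_α ∈ C_β` for `α < β`, and
`C_α = ⋃_{ξ < α} C_ξ` for limit `α`. -/
def IsContinuousIncreasingChain (δ : Ordinal.{u}) (C : Ordinal.{u} → ZFSet.{u}) : Prop :=
  (∀ α β, α < β → β < δ → C α ∈ C β) ∧
    ∀ α, α < δ → Order.IsSuccLimit α → ∀ x, x ∈ C α ↔ ∃ ξ < α, x ∈ C ξ

/-- `N` is an `n`-model. A `0`-model is a member of `Sub(κ)`; an `(n+1)`-model is a member `N` of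
`Sub(κ)` which is the union of a continuous increasing chain `{N_α | α < δ_N} ⊆ N` of `n`-models. -/
def IsNModel (κ : Cardinal.{u}) (r : H κ → H κ → Prop) : ℕ → ZFSet.{u} → Prop
  | 0, N => IsSub κ r N
  | n + 1, N => IsSub κ r N ∧ ∃ C : Ordinal.{u} → ZFSet.{u},
      IsContinuousIncreasingChain (height N) C ∧
      (∀ α < height N, C α ∈ N ∧ IsNModel κ r n (C α)) ∧
      ∀ x, x ∈ N ↔ ∃ α < height N, x ∈ C α

/-- The sequence `⟨M_0, …, M_n⟩` of members of `Sub(κ)` is `δ`-increasing. -/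
def IsDeltaIncreasing (κ : Cardinal.{u}) (r : H κ → H κ → Prop) {n : ℕ}
    (M : Fin (n + 1) → ZFSet.{u}) : Prop :=
  (∀ i, IsSub κ r (M i)) ∧ ∀ i : Fin n, height (M i.castSucc) ≤ height (M i.succ)

/-- A partition is a collection of pairwise disjoint sets (the empty set may be one of them). -/
def IsPartition (P : ZFSet.{u}) : Prop :=
  ∀ A ∈ P, ∀ B ∈ P, A ≠ B → A ∩ B = ∅

/-- `P = ⟨P_i | i ≤ n⟩` is a decisive partition (of countable subsets of `ω_l`) for
`⟨M_0, …, M_n⟩`. -/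
def IsDecisivePartition (l : ℕ) {n : ℕ} (M P : Fin (n + 1) → ZFSet.{u}) : Prop :=
  (∀ i, P i ∈ M i ∧ IsPartition (P i) ∧ (P i : Set ZFSet.{u}).Finite ∧
    ∀ A ∈ P i, A ⊆ (ω_ (l : Ordinal.{u})).toZFSet ∧ (A : Set ZFSet.{u}).Countable) ∧
  ∀ i j, i < j → ∀ A ∈ P i, A ∈ P j ∨ A ∩ M j = ∅

/-- `R ⪯ P` (for partitions): every element of `R` is contained in one of `P`, and every element of
`P` is the union of some elements of `R`. -/
def Refines (R P : ZFSet.{u}) : Prop :=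
  (∀ A ∈ R, ∃ B ∈ P, A ⊆ B) ∧ ∀ B ∈ P, ∃ S, S ⊆ R ∧ B = ZFSet.sUnion S

/-- `R ⪯₂ P`: `R ⪯ P`, and every element of `P` is the union of at most two elements of `R`. -/
def TwoRefines (R P : ZFSet.{u}) : Prop :=
  Refines R P ∧
    ∀ B ∈ P, ∃ S, S ⊆ R ∧ (S : Set ZFSet.{u}).encard ≤ 2 ∧ B = ZFSet.sUnion S

end SubmodelComb

/-!
The refinement is canonical: `R i` consists of the sets `A ∩ L` and `A \ L` for `A ∈ P i`. It is
then automatically a decisive partition and a 2-refinement, provided that `A ∩ L` belongs to both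
`M i` and `L`. So everything rests on `exists_inter_mem`: for finitely many countable sets
`A i ⊆ ω_l` with `A i ∈ M i`, an `l`-model `N` above the `M i` has an element `L` with
`A i ∩ L ∈ M i` and `A i ∩ L ∈ L`.

This is proved by induction on `l`. For `l = 1`, the well-order of `H(κ)` and the continuum
hypothesis give an injection of the countable subsets of `ω₁` into `ω₁` that lies in every
elementary submodel, so a countable subset of `ω₁` that belongs to `M i` belongs to every higher
model (`IsSub.mem_of_subset_omega_one`), and any late member of the chain of `N` serves as `L`.

For the step, let `C α` be the chain of `N`, and let `γ i` be the strict supremum of `A i ∩ C α`. If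
a model contains a countable set of ordinals, it contains the strict supremum of each of its subsets
(`IsSub.ssup_mem_of_subset`); hence `γ i ∈ M i`, and `γ i ∈ C β` for all `β > α`. Along those
`α` for which `γ i ∉ C α`, the ordinal `γ i` is therefore strictly increasing, and since the order
type of `A i` is below `δ_{M i}`, these `α` embed increasingly into an ordinal below `δ_N`. As `δ_N`
is closed under multiplication, finitely many such sets do not exhaust its tails
(`exists_notMem_of_isPrincipal_mul`), so some late `α` has `γ i ∈ C α` for all `i`
(`exists_ssup_mem_chain`). The least injection of `γ i` into `ω_{l-1}` belongs to `M i` and to every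
model that contains `γ i`. It carries `A i ∩ γ i` to a countable subset of `ω_{l-1}`, to which the
induction hypothesis applies inside the model `C α`. Since the resulting `L` is a subset of `C α`,
the set `A i ∩ L` is contained in `γ i` and can be pulled back.

Elementarity is used through `IsDef`, a semantic notion of first-order definability closed under
connectives and quantifiers, and `IsSub.exists_mem`, the Tarski–Vaught property.
-/

universe v

namespace SubmodelComb

/-! ### Definable relations and elementarity -/

section Definability

variable {κ : Cardinal.{u}} {r : H κ → H κ → Prop} {n : ℕ}

/-- The `n`-ary relation `p` is first-order definable without parameters over `(H(κ), ∈, r)`. The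
relation is a predicate on tuples, so that closure under connectives and quantifiers can be stated
without mentioning formulas. -/
def IsDef (r : H κ → H κ → Prop) {n : ℕ} (p : (Fin n → H κ) → Prop) : Prop :=
  letI := structureH κ r
  ∃ φ : setWOLanguage.Formula (Fin n), ∀ v, φ.Realize v ↔ p v

namespace IsDef

theorem mem (i j : Fin n) : IsDef r fun v : Fin n → H κ => (v i).1 ∈ (v j).1 := by
  let _ := structureH κ r
  refine ⟨FirstOrder.Language.Relations.formula₂ (L := setWOLanguage) SetWORel.mem
    (FirstOrder.Language.Term.var i) (FirstOrder.Language.Term.var j), fun v => ?_⟩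
  exact FirstOrder.Language.Formula.realize_rel₂.trans Iff.rfl

theorem rel (i j : Fin n) : IsDef r fun v : Fin n → H κ => r (v i) (v j) := by
  let _ := structureH κ r
  refine ⟨FirstOrder.Language.Relations.formula₂ (L := setWOLanguage) SetWORel.wo
    (FirstOrder.Language.Term.var i) (FirstOrder.Language.Term.var j), fun v => ?_⟩
  exact FirstOrder.Language.Formula.realize_rel₂.trans Iff.rfl

theorem eq (i j : Fin n) : IsDef r fun v : Fin n → H κ => v i = v j := by
  let _ := structureH κ r
  refine ⟨FirstOrder.Language.Term.equal
    (FirstOrder.Language.Term.var i) (FirstOrder.Language.Term.var j), fun v => ?_⟩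
  rw [FirstOrder.Language.Formula.realize_equal]
  rfl

theorem not {p : (Fin n → H κ) → Prop} (hp : IsDef r p) : IsDef r fun v => ¬ p v := by
  obtain ⟨φ, hφ⟩ := hp
  let _ := structureH κ r
  exact ⟨φ.not, fun v => (FirstOrder.Language.Formula.realize_not).trans (not_congr (hφ v))⟩

theorem and {p q : (Fin n → H κ) → Prop} (hp : IsDef r p) (hq : IsDef r q) :
    IsDef r fun v => p v ∧ q v := by
  obtain ⟨φ, hφ⟩ := hp
  obtain ⟨ψ, hψ⟩ := hq
  let _ := structureH κ r
  exact ⟨φ ⊓ ψ, fun v => FirstOrder.Language.Formula.realize_inf.trans (and_congr (hφ v) (hψ v))⟩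

theorem comp {m : ℕ} {p : (Fin m → H κ) → Prop} (hp : IsDef r p) (g : Fin m → Fin n) :
    IsDef r fun v => p fun i => v (g i) := by
  obtain ⟨φ, hφ⟩ := hp
  let _ := structureH κ r
  exact ⟨φ.relabel g, fun v => FirstOrder.Language.Formula.realize_relabel.trans (hφ _)⟩

theorem congr {p q : (Fin n → H κ) → Prop} (hp : IsDef r p) (h : ∀ v, q v ↔ p v) :
    IsDef r q := by
  rwa [show q = p from funext fun v => propext (h v)]

theorem or {p q : (Fin n → H κ) → Prop} (hp : IsDef r p) (hq : IsDef r q) :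
    IsDef r fun v => p v ∨ q v :=
  (hp.not.and hq.not).not.congr fun v => by tauto

theorem imp {p q : (Fin n → H κ) → Prop} (hp : IsDef r p) (hq : IsDef r q) :
    IsDef r fun v => p v → q v :=
  (hp.and hq.not).not.congr fun v => by tauto

theorem iff {p q : (Fin n → H κ) → Prop} (hp : IsDef r p) (hq : IsDef r q) :
    IsDef r fun v => (p v ↔ q v) :=
  ((hp.imp hq).and (hq.imp hp)).congr fun v => by tauto

/-- The quantified variable becomes variable `0` of the matrix, and the free variables are shifted
by one. -/
theorem ex {p : (Fin n → H κ) → H κ → Prop}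
    (hp : IsDef r fun w : Fin (n + 1) → H κ => p (fun i => w i.succ) (w 0)) :
    IsDef r fun v => ∃ x, p v x := by
  obtain ⟨φ, hφ⟩ := hp
  let _ := structureH κ r
  let g : Fin (n + 1) → Fin n ⊕ Fin 1 := Fin.cons (Sum.inr 0) Sum.inl
  refine ⟨(φ.relabel g).iExs (Fin 1), fun v => ?_⟩
  rw [FirstOrder.Language.Formula.realize_iExs]
  have key : ∀ i : Fin 1 → H κ, (φ.relabel g).Realize (Sum.elim v i) ↔ p v (i 0) := fun i => by
    rw [FirstOrder.Language.Formula.realize_relabel, hφ]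
    rfl
  exact ⟨fun ⟨i, hi⟩ => ⟨i 0, (key i).1 hi⟩, fun ⟨x, hx⟩ => ⟨fun _ => x, (key _).2 hx⟩⟩

theorem all {p : (Fin n → H κ) → H κ → Prop}
    (hp : IsDef r fun w : Fin (n + 1) → H κ => p (fun i => w i.succ) (w 0)) :
    IsDef r fun v => ∀ x, p v x :=
  (IsDef.ex (p := fun v x => ¬ p v x) hp.not).not.congr fun v => by simp

end IsDef

/-- The Tarski–Vaught property of elementary submodels. -/
theorem IsSub.exists_mem {M : ZFSet.{u}} (hM : IsSub κ r M) {p : (Fin n → H κ) → H κ → Prop}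
    (hp : IsDef r fun w : Fin (n + 1) → H κ => p (fun i => w i.succ) (w 0))
    (v : Fin n → H κ) (hv : ∀ i, (v i).1 ∈ M) (h : ∃ x, p v x) : ∃ x, x.1 ∈ M ∧ p v x := by
  obtain ⟨-, -, S, hS⟩ := hM
  obtain ⟨φ, hφ⟩ := hp
  obtain ⟨ψ, hψ⟩ : ∃ ψ : setWOLanguage.Formula (Fin n), ∀ (T : Type (u + 1))
      [setWOLanguage.Structure T] (w : Fin n → T),
      ψ.Realize w ↔ ∃ x, φ.Realize (Fin.cons x w : Fin (n + 1) → T) := by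
    let g : Fin (n + 1) → Fin n ⊕ Fin 1 := Fin.cons (Sum.inr 0) Sum.inl
    refine ⟨(φ.relabel g).iExs (Fin 1), fun T _ w => ?_⟩
    rw [FirstOrder.Language.Formula.realize_iExs]
    have key : ∀ i : Fin 1 → T, (φ.relabel g).Realize (Sum.elim w i) ↔
        φ.Realize (Fin.cons (i 0) w : Fin (n + 1) → T) := fun i => by
      rw [FirstOrder.Language.Formula.realize_relabel]
      have : Sum.elim w i ∘ g = Fin.cons (i 0) w := by
        funext j
        refine Fin.cases ?_ (fun j => ?_) j <;> rfl
      rw [this]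
    exact ⟨fun ⟨i, hi⟩ => ⟨i 0, (key i).1 hi⟩, fun ⟨x, hx⟩ => ⟨fun _ => x, (key _).2 hx⟩⟩
  let _ := structureH κ r
  let w : Fin n → S := fun i => ⟨v i, (hS _).2 (hv i)⟩
  have h1 : ψ.Realize v := (hψ _ v).2 (by
    obtain ⟨x, hx⟩ := h
    exact ⟨x, (hφ _).2 hx⟩)
  have h2 : ψ.Realize w := (S.isElementary ψ w).1 h1
  obtain ⟨x, hx⟩ := (hψ _ w).1 h2
  have h3 := (S.isElementary φ _).2 hx
  refine ⟨x.1, (hS _).1 x.2, ?_⟩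
  have h4 := (hφ _).1 h3
  exact h4

/-- If a definable relation has a witness at parameters `v`, its `r`-least witness belongs to every
elementary submodel containing the parameters. -/
theorem exists_common_witness (hr : IsWellOrder (H κ) r) {p : (Fin n → H κ) → H κ → Prop}
    (hp : IsDef r fun w : Fin (n + 1) → H κ => p (fun i => w i.succ) (w 0))
    (v : Fin n → H κ) (h : ∃ x, p v x) :
    ∃ x, p v x ∧ ∀ M, IsSub κ r M → (∀ i, (v i).1 ∈ M) → x.1 ∈ M := by
  have hp' : IsDef r fun w : Fin (n + 2) → H κ => p (fun i => w i.succ.succ) (w 0) :=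
    hp.comp (Fin.cons 0 fun i => i.succ.succ)
  have wf : WellFounded r := hr.wf
  refine ⟨wf.min {x | p v x} h, wf.min_mem {x | p v x} h, fun M hM hv => ?_⟩
  obtain ⟨y, hyM, hy, hy'⟩ := hM.exists_mem (p := fun v x => p v x ∧ ∀ y, p v y → ¬ r y x)
    (hp.and (IsDef.all (hp'.imp (IsDef.rel _ _).not))) v hv
    ⟨wf.min {x | p v x} h, wf.min_mem {x | p v x} h, fun y hy => wf.not_lt_min {x | p v x} hy⟩
  have : y = wf.min {x | p v x} h := by
    rcases trichotomous_of r y (wf.min {x | p v x} h) with h1 | h1 | h1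
    · exact absurd h1 (wf.not_lt_min {x | p v x} hy)
    · exact h1
    · exact absurd h1 (hy' _ (wf.min_mem {x | p v x} h))
  rwa [← this]

end Definability

/-! ### The sets in `H(κ)` -/

section HFacts

variable {κ : Cardinal.{u}}

theorem mem_H_of_mem {x y : ZFSet.{u}} (hx : x ∈ H κ) (hy : y ∈ x) : y ∈ H κ := by
  refine lt_of_le_of_lt (Cardinal.mk_le_mk_of_subset fun z hz => ?_) hx
  exact Relation.TransGen.tail hz hy

theorem card_lt_of_mem_H {x : ZFSet.{u}} (hx : x ∈ H κ) :
    #(x : Set ZFSet.{u}) < Cardinal.lift.{u + 1} κ := by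
  refine lt_of_le_of_lt (Cardinal.mk_le_mk_of_subset fun z hz => ?_) hx
  exact Relation.TransGen.single hz

theorem mem_H_of_transitive {x : ZFSet.{u}} (hx : x.IsTransitive)
    (h : #(x : Set ZFSet.{u}) < Cardinal.lift.{u + 1} κ) : x ∈ H κ := by
  refine lt_of_le_of_lt (Cardinal.mk_le_mk_of_subset fun z hz => ?_) h
  replace hz : Relation.TransGen (fun a b : ZFSet.{u} => a ∈ b) z x := hz
  change z ∈ x
  clear h
  induction hz using Relation.TransGen.head_induction_on with
  | single h => exact h
  | head h _ ih => exact hx.subset_of_mem ih h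

/-- Extensionality inside `H(κ)`, which is transitive. -/
theorem H_ext {x y : H κ} (h : ∀ z : H κ, z.1 ∈ x.1 ↔ z.1 ∈ y.1) : x = y := by
  refine Subtype.ext (ZFSet.ext fun z => ⟨fun hz => ?_, fun hz => ?_⟩)
  · exact (h ⟨z, mem_H_of_mem x.2 hz⟩).1 hz
  · exact (h ⟨z, mem_H_of_mem y.2 hz⟩).2 hz

theorem card_toZFSet_coe (α : Ordinal.{u}) :
    #(α.toZFSet : Set ZFSet.{u}) = Cardinal.lift.{u + 1} α.card := by
  rw [← Ordinal.card_toZFSet]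
  exact ZFSet.cardinalMk_coe_sort

theorem toZFSet_mem_H {α : Ordinal.{u}} (h : α.card < κ) : α.toZFSet ∈ H κ := by
  refine mem_H_of_transitive (ZFSet.isOrdinal_toZFSet α).isTransitive ?_
  rw [card_toZFSet_coe]
  exact Cardinal.lift_lt.2 h

theorem of_pair_mem_H {x y : ZFSet.{u}} (h : ZFSet.pair x y ∈ H κ) : x ∈ H κ ∧ y ∈ H κ := by
  have h1 : ({x, y} : ZFSet.{u}) ∈ H κ := mem_H_of_mem h (by simp [ZFSet.pair])
  exact ⟨mem_H_of_mem h1 (by simp), mem_H_of_mem h1 (by simp)⟩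

variable [hκ : Fact κ.IsRegular]

theorem mem_H_of_subset {x : ZFSet.{u}} (hx : ∀ y ∈ x, y ∈ H κ)
    (h : #(x : Set ZFSet.{u}) < Cardinal.lift.{u + 1} κ) : x ∈ H κ := by
  have hreg : (Cardinal.lift.{u + 1} κ).IsRegular := hκ.out.lift
  have hU : #(⋃ y ∈ (x : Set ZFSet.{u}), {z | Relation.TransGen (fun a b : ZFSet.{u} => a ∈ b) z y} :
      Set ZFSet.{u}) < Cardinal.lift.{u + 1} κ :=
    (card_biUnion_lt_iff_forall_of_isRegular hreg h).2 fun y hy => hx y hy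
  refine lt_of_le_of_lt (Cardinal.mk_le_mk_of_subset (t := (x : Set ZFSet.{u}) ∪ ⋃ y ∈
    (x : Set ZFSet.{u}), {z | Relation.TransGen (fun a b : ZFSet.{u} => a ∈ b) z y}) ?_)
    ((Cardinal.mk_union_le _ _).trans_lt (Cardinal.add_lt_of_lt hreg.aleph0_le h hU))
  intro z hz
  have hz : Relation.TransGen (fun a b : ZFSet.{u} => a ∈ b) z x := hz
  rcases Relation.TransGen.tail'_iff.1 hz with ⟨y, hzy, hyx⟩
  rcases Relation.reflTransGen_iff_eq_or_transGen.1 hzy with rfl | hzy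
  · exact Or.inl hyx
  · exact Or.inr (Set.mem_biUnion hyx hzy)

/-- A set of fewer than `κ` members of `H(κ)` is a member of `H(κ)`. -/
theorem exists_H_eq {s : Set ZFSet.{u}} (hs : s ⊆ H κ) (h : #s < Cardinal.lift.{u + 1} κ) :
    ∃ x : H κ, ∀ t, t ∈ x.1 ↔ t ∈ s := by
  have : Small.{u} s := by
    obtain ⟨c, -, hc⟩ := Cardinal.lt_lift_iff.1 h
    induction c using Cardinal.inductionOn with
    | mk α =>
      obtain ⟨e⟩ := Cardinal.lift_mk_eq'.1 (hc.trans (Cardinal.lift_id'.{u, u + 1} #s).symm)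
      exact ⟨α, ⟨e.symm⟩⟩
  have hmem : ∀ t, t ∈ ZFSet.range (fun t : s => t.1) ↔ t ∈ s := fun t => by simp
  refine ⟨⟨_, mem_H_of_subset (fun y hy => hs ((hmem y).1 hy)) ?_⟩, hmem⟩
  have : ((ZFSet.range fun t : s => t.1 : ZFSet.{u}) : Set ZFSet.{u}) = s := Set.ext hmem
  rwa [this]

theorem finite_card_lt {s : Set ZFSet.{u}} (hs : s.Finite) : #s < Cardinal.lift.{u + 1} κ :=
  (Cardinal.lt_aleph0_iff_set_finite.2 hs).trans_le hκ.out.lift.aleph0_le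

theorem insert_mem_H {x y : ZFSet.{u}} (hx : x ∈ H κ) (hy : y ∈ H κ) : insert x y ∈ H κ := by
  refine mem_H_of_subset (fun z hz => ?_) ?_
  · rcases ZFSet.mem_insert_iff.1 hz with rfl | h
    · exact hx
    · exact mem_H_of_mem hy h
  · rw [ZFSet.coe_insert]
    exact Cardinal.mk_insert_le.trans_lt (Cardinal.add_lt_of_lt hκ.out.lift.aleph0_le
      (card_lt_of_mem_H hy) (Cardinal.one_lt_aleph0.trans_le hκ.out.lift.aleph0_le))

theorem subset_mem_H {x y : ZFSet.{u}} (hy : y ∈ H κ) (h : x ⊆ y) : x ∈ H κ :=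
  mem_H_of_subset (fun _ hz => mem_H_of_mem hy (h hz))
    ((Cardinal.mk_le_mk_of_subset (ZFSet.coe_subset_coe.2 h)).trans_lt (card_lt_of_mem_H hy))

theorem empty_mem_H : (∅ : ZFSet.{u}) ∈ H κ :=
  mem_H_of_subset (fun y hy => absurd hy (ZFSet.notMem_empty y)) (by
    rw [ZFSet.coe_empty]; exact finite_card_lt Set.finite_empty)

theorem singleton_mem_H {x : ZFSet.{u}} (hx : x ∈ H κ) : ({x} : ZFSet.{u}) ∈ H κ := by
  rw [← insert_empty_eq]
  exact insert_mem_H hx empty_mem_H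

theorem pair_mem_H {x y : ZFSet.{u}} (hx : x ∈ H κ) (hy : y ∈ H κ) : ZFSet.pair x y ∈ H κ :=
  insert_mem_H (singleton_mem_H hx) (singleton_mem_H (insert_mem_H hx (singleton_mem_H hy)))

end HFacts

/-! ### Definable set-theoretic notions and closure of elementary submodels -/

section MoreDef

variable {κ : Cardinal.{u}} {r : H κ → H κ → Prop} {n : ℕ}

namespace IsDef

theorem subset (i j : Fin n) : IsDef r fun v : Fin n → H κ => (v i).1 ⊆ (v j).1 := by
  refine IsDef.congr (p := fun v => ∀ z : H κ, z.1 ∈ (v i).1 → z.1 ∈ (v j).1)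
    (all ((mem _ _).imp (mem _ _))) fun v => ?_
  exact ⟨fun h z hz => h hz, fun h z hz => h ⟨z, mem_H_of_mem (v i).2 hz⟩ hz⟩

theorem eq_insert (i j k : Fin n) :
    IsDef r fun v : Fin n → H κ => (v i).1 = insert (v j).1 (v k).1 := by
  refine IsDef.congr (p := fun v => ((v j).1 ∈ (v i).1) ∧
    ∀ z : H κ, (z.1 ∈ (v i).1 → z = v j ∨ z.1 ∈ (v k).1) ∧ (z.1 ∈ (v k).1 → z.1 ∈ (v i).1))
    ((mem _ _).and (all (((mem _ _).imp ((eq _ _).or (mem _ _))).and ((mem _ _).imp (mem _ _)))))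
    fun v => ?_
  constructor
  · intro h
    refine ⟨by simp [h], fun z => ⟨fun hz => ?_, fun hz => by simp [h, hz]⟩⟩
    rw [h, ZFSet.mem_insert_iff] at hz
    exact hz.imp_left Subtype.ext
  · rintro ⟨h1, h2⟩
    ext z
    rw [ZFSet.mem_insert_iff]
    constructor
    · intro hz
      exact ((h2 ⟨z, mem_H_of_mem (v i).2 hz⟩).1 hz).imp_left (congrArg Subtype.val)
    · rintro (rfl | hz)
      · exact h1
      · exact (h2 ⟨z, mem_H_of_mem (v k).2 hz⟩).2 hz

theorem eq_empty (i : Fin n) : IsDef r fun v : Fin n → H κ => (v i).1 = ∅ := by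
  refine IsDef.congr (p := fun v => ∀ z : H κ, ¬ z.1 ∈ (v i).1) (all (mem _ _).not) fun v => ?_
  rw [ZFSet.eq_empty]
  exact ⟨fun h z => h z.1, fun h z hz => h ⟨z, mem_H_of_mem (v i).2 hz⟩ hz⟩

theorem isOrdinal (i : Fin n) : IsDef r fun v : Fin n → H κ => (v i).1.IsOrdinal := by
  refine IsDef.congr (p := fun v => ∀ y : H κ, y.1 ∈ (v i).1 → y.1 ⊆ (v i).1 ∧
    ∀ z : H κ, z.1 ∈ y.1 → ∀ x : H κ, x.1 ∈ z.1 → x.1 ∈ y.1)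
    (all ((mem _ _).imp ((subset _ _).and
      (all ((mem _ _).imp (all ((mem _ _).imp (mem _ _)))))))) fun v => ?_
  constructor
  · exact fun h y hy => ⟨h.subset_of_mem hy, fun z hz x hx => (h.mem hy).subset_of_mem hz hx⟩
  · intro h
    refine ⟨fun y hy => (h ⟨y, mem_H_of_mem (v i).2 hy⟩ hy).1, fun {x y z} hx hy hz => ?_⟩
    have hzH : z ∈ H κ := mem_H_of_mem (v i).2 hz
    have hyH := mem_H_of_mem hzH hy
    exact (h ⟨z, hzH⟩ hz).2 ⟨y, hyH⟩ hy ⟨x, mem_H_of_mem hyH hx⟩ hx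

variable [hκ : Fact κ.IsRegular]

theorem eq_pair (i j k : Fin n) :
    IsDef r fun v : Fin n → H κ => (v i).1 = ZFSet.pair (v j).1 (v k).1 := by
  refine IsDef.congr (p := fun v => ∃ e a b b' c : H κ, e.1 = ∅ ∧ a.1 = insert (v j).1 e.1 ∧
    b'.1 = insert (v k).1 e.1 ∧ b.1 = insert (v j).1 b'.1 ∧ c.1 = insert b.1 e.1 ∧
    (v i).1 = insert a.1 c.1)
    (ex (ex (ex (ex (ex ((eq_empty _).and ((eq_insert _ _ _).and ((eq_insert _ _ _).and
      ((eq_insert _ _ _).and ((eq_insert _ _ _).and (eq_insert _ _ _))))))))))) fun v => ?_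
  constructor
  · intro h
    refine ⟨⟨∅, empty_mem_H⟩, ⟨{(v j).1}, singleton_mem_H (v j).2⟩,
      ⟨{(v j).1, (v k).1}, insert_mem_H (v j).2 (singleton_mem_H (v k).2)⟩,
      ⟨{(v k).1}, singleton_mem_H (v k).2⟩,
      ⟨{{(v j).1, (v k).1}}, singleton_mem_H (insert_mem_H (v j).2 (singleton_mem_H (v k).2))⟩,
      rfl, ?_, ?_, rfl, ?_, h⟩ <;> simp
  · rintro ⟨e, a, b, b', c, he, ha, hb', hb, hc, h⟩
    rw [h, hc, hb, hb', ha, he]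
    simp [ZFSet.pair]

theorem pair_mem (i j k : Fin n) :
    IsDef r fun v : Fin n → H κ => ZFSet.pair (v i).1 (v j).1 ∈ (v k).1 := by
  refine IsDef.congr (p := fun v => ∃ p : H κ, p.1 = ZFSet.pair (v i).1 (v j).1 ∧ p.1 ∈ (v k).1)
    (ex ((eq_pair _ _ _).and (mem _ _))) fun v => ?_
  exact ⟨fun h => ⟨⟨_, pair_mem_H (v i).2 (v j).2⟩, rfl, h⟩, fun ⟨p, hp, h⟩ => hp ▸ h⟩

theorem triple_mem (i j k l : Fin n) : IsDef r fun v : Fin n → H κ =>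
    ZFSet.pair (ZFSet.pair (v i).1 (v j).1) (v k).1 ∈ (v l).1 := by
  refine IsDef.congr (p := fun v => ∃ p : H κ, p.1 = ZFSet.pair (v i).1 (v j).1 ∧
    ZFSet.pair p.1 (v k).1 ∈ (v l).1) (ex ((eq_pair _ _ _).and (pair_mem _ _ _))) fun v => ?_
  exact ⟨fun h => ⟨⟨_, pair_mem_H (v i).2 (v j).2⟩, rfl, h⟩, fun ⟨p, hp, h⟩ => hp ▸ h⟩

end IsDef

variable {M : ZFSet.{u}}

theorem IsSub.mem_H (hM : IsSub κ r M) {x : ZFSet.{u}} (hx : x ∈ M) : x ∈ H κ := hM.2.1 hx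

/-- An element of `H(κ)` defined by a definable property of parameters in `M` belongs to `M`. -/
theorem IsSub.mem_of_unique (hM : IsSub κ r M) {p : (Fin n → H κ) → H κ → Prop}
    (hp : IsDef r fun w : Fin (n + 1) → H κ => p (fun i => w i.succ) (w 0))
    (v : Fin n → H κ) (hv : ∀ i, (v i).1 ∈ M) (x : H κ) (hx : p v x)
    (huniq : ∀ y, p v y → y = x) : x.1 ∈ M := by
  obtain ⟨y, hy, hpy⟩ := hM.exists_mem hp v hv ⟨x, hx⟩
  rwa [← huniq y hpy]

/-- A set in `H(κ)` whose elements are defined by a definable property of parameters in `M`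
belongs to `M`. -/
theorem IsSub.mem_of_forall_mem_iff (hM : IsSub κ r M) {q : (Fin n → H κ) → H κ → Prop}
    (hq : IsDef r fun w : Fin (n + 1) → H κ => q (fun i => w i.succ) (w 0))
    (v : Fin n → H κ) (hv : ∀ i, (v i).1 ∈ M) (x : ZFSet.{u}) (hxH : x ∈ H κ)
    (hx : ∀ t : H κ, t.1 ∈ x ↔ q v t) : x ∈ M := by
  have hq' : IsDef r fun w : Fin (n + 2) → H κ => q (fun i => w i.succ.succ) (w 0) :=
    hq.comp (Fin.cons 0 fun i => i.succ.succ)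
  refine hM.mem_of_unique (p := fun v y => ∀ t : H κ, t.1 ∈ y.1 ↔ q v t)
    (IsDef.all ((IsDef.mem _ _).iff hq')) v hv ⟨x, hxH⟩ hx fun y hy => ?_
  exact H_ext fun t => (hy t).trans (hx t).symm

variable [hκ : Fact κ.IsRegular]

theorem IsSub.inter_mem (hM : IsSub κ r M) {x y : ZFSet.{u}} (hx : x ∈ M) (hy : y ∈ M) :
    x ∩ y ∈ M := by
  refine hM.mem_of_forall_mem_iff (q := fun v t => t.1 ∈ (v 0).1 ∧ t.1 ∈ (v 1).1)
    ((IsDef.mem _ _).and (IsDef.mem _ _)) ![⟨x, hM.mem_H hx⟩, ⟨y, hM.mem_H hy⟩]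
    (by simp [Fin.forall_fin_two, hx, hy]) _
    (subset_mem_H (hM.mem_H hx) fun z hz => (ZFSet.mem_inter.1 hz).1) fun t => by simp

theorem IsSub.sdiff_mem (hM : IsSub κ r M) {x y : ZFSet.{u}} (hx : x ∈ M) (hy : y ∈ M) :
    x \ y ∈ M := by
  refine hM.mem_of_forall_mem_iff (q := fun v t => t.1 ∈ (v 0).1 ∧ ¬ t.1 ∈ (v 1).1)
    ((IsDef.mem _ _).and (IsDef.mem _ _).not) ![⟨x, hM.mem_H hx⟩, ⟨y, hM.mem_H hy⟩]
    (by simp [Fin.forall_fin_two, hx, hy]) _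
    (subset_mem_H (hM.mem_H hx) fun z hz => (ZFSet.mem_sdiff.1 hz).1) fun t => by simp

theorem IsSub.insert_mem (hM : IsSub κ r M) {x y : ZFSet.{u}} (hx : x ∈ M) (hy : y ∈ M) :
    insert x y ∈ M :=
  hM.mem_of_unique (p := fun v t => t.1 = insert (v 0).1 (v 1).1) (IsDef.eq_insert _ _ _)
    ![⟨x, hM.mem_H hx⟩, ⟨y, hM.mem_H hy⟩] (by simp [Fin.forall_fin_two, hx, hy])
    ⟨_, insert_mem_H (hM.mem_H hx) (hM.mem_H hy)⟩ rfl fun _ h => Subtype.ext h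

theorem IsSub.empty_mem (hM : IsSub κ r M) : (∅ : ZFSet.{u}) ∈ M :=
  hM.mem_of_unique (p := fun (_ : Fin 0 → H κ) t => t.1 = ∅) (IsDef.eq_empty _)
    ![] (fun i => i.elim0) ⟨_, empty_mem_H⟩ rfl fun _ h => Subtype.ext h

theorem IsSub.mem_of_finite (hM : IsSub κ r M) {x : ZFSet.{u}}
    (hx : (x : Set ZFSet.{u}).Finite) (h : ∀ y ∈ x, y ∈ M) : x ∈ M := by
  have key : ∀ s : Set ZFSet.{u}, s.Finite → s ⊆ (M : Set ZFSet.{u}) →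
      ∃ y ∈ M, (y : Set ZFSet.{u}) = s := by
    intro s hs
    induction s, hs using Set.Finite.induction_on with
    | empty => exact fun _ => ⟨∅, hM.empty_mem, ZFSet.coe_empty⟩
    | @insert a s _ _ ih =>
      intro hsub
      obtain ⟨y, hy, hys⟩ := ih ((Set.subset_insert a s).trans hsub)
      exact ⟨insert a y, hM.insert_mem (hsub (Set.mem_insert a s)) hy, by
        rw [ZFSet.coe_insert, hys]⟩
  obtain ⟨y, hy, hyx⟩ := key _ hx h
  rwa [SetLike.coe_injective hyx] at hy

end MoreDef

/-! ### Codes of injections -/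

/-- `e` codes an injection of `x` into `w`: for every `a ∈ x` there is `n ∈ w` with
`(n, a) ∈ e`, and `e` is the graph of a bijection between its domain and its range. -/
def IsInjCode (e x w : ZFSet.{u}) : Prop :=
  (∀ a ∈ x, ∃ n ∈ w, ZFSet.pair n a ∈ e) ∧
    ∀ n a n' a', ZFSet.pair n a ∈ e → ZFSet.pair n' a' ∈ e → (n = n' ↔ a = a')

section InjCode

variable {κ : Cardinal.{u}} {r : H κ → H κ → Prop}

theorem IsInjCode.card_le {e x w : ZFSet.{u}} (he : IsInjCode e x w) :
    #(x : Set ZFSet.{u}) ≤ #(w : Set ZFSet.{u}) := by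
  choose f hf hfe using he.1
  refine Cardinal.mk_le_of_injective (f := fun a : (x : Set ZFSet.{u}) => ⟨f a.1 a.2, hf a.1 a.2⟩) ?_
  intro a b hab
  exact Subtype.ext ((he.2 _ _ _ _ (hfe a.1 a.2) (hfe b.1 b.2)).1 (congrArg Subtype.val hab))

variable [hκ : Fact κ.IsRegular]

theorem exists_isInjCode {x w : ZFSet.{u}} (hx : x ∈ H κ) (hw : w ∈ H κ)
    (h : #(x : Set ZFSet.{u}) ≤ #(w : Set ZFSet.{u})) : ∃ e : H κ, IsInjCode e.1 x w := by
  obtain ⟨f⟩ := h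
  obtain ⟨e, he⟩ := exists_H_eq (κ := κ)
    (s := Set.range fun a : (x : Set ZFSet.{u}) => ZFSet.pair (f a).1 a.1)
    (by
      rintro _ ⟨a, rfl⟩
      exact pair_mem_H (mem_H_of_mem hw (f a).2) (mem_H_of_mem hx a.2))
    (Cardinal.mk_range_le.trans_lt (card_lt_of_mem_H hx))
  have hpair : ∀ n a, ZFSet.pair n a ∈ e.1 ↔ ∃ b : (x : Set ZFSet.{u}), (f b).1 = n ∧ b.1 = a := by
    intro n a
    rw [he]
    simp only [Set.mem_range, ZFSet.pair_inj]
  refine ⟨e, fun a ha => ⟨f ⟨a, ha⟩, (f ⟨a, ha⟩).2, (hpair _ _).2 ⟨⟨a, ha⟩, rfl, rfl⟩⟩, ?_⟩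
  intro n a n' a' h1 h2
  obtain ⟨b, rfl, rfl⟩ := (hpair _ _).1 h1
  obtain ⟨b', rfl, rfl⟩ := (hpair _ _).1 h2
  rw [← Subtype.ext_iff, ← Subtype.ext_iff, f.injective.eq_iff]

theorem IsDef.isInjCode {n : ℕ} (i j k : Fin n) :
    IsDef r fun v : Fin n → H κ => IsInjCode (v i).1 (v j).1 (v k).1 := by
  refine IsDef.congr (p := fun v =>
    (∀ a : H κ, a.1 ∈ (v j).1 → ∃ m : H κ, m.1 ∈ (v k).1 ∧ ZFSet.pair m.1 a.1 ∈ (v i).1) ∧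
    ∀ m a m' a' : H κ, ZFSet.pair m.1 a.1 ∈ (v i).1 → ZFSet.pair m'.1 a'.1 ∈ (v i).1 →
      (m = m' ↔ a = a'))
    ((all ((mem _ _).imp (ex ((mem _ _).and (pair_mem _ _ _))))).and
      (all (all (all (all ((pair_mem _ _ _).imp ((pair_mem _ _ _).imp
        ((eq _ _).iff (eq _ _))))))))) fun v => ?_
  constructor
  · rintro ⟨h1, h2⟩
    refine ⟨fun a ha => ?_, fun m a m' a' h h' => ?_⟩
    · obtain ⟨m, hm, hp⟩ := h1 a.1 ha
      exact ⟨⟨m, mem_H_of_mem (v k).2 hm⟩, hm, hp⟩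
    · rw [Subtype.ext_iff, Subtype.ext_iff]
      exact h2 _ _ _ _ h h'
  · rintro ⟨h1, h2⟩
    refine ⟨fun a ha => ?_, fun m a m' a' h h' => ?_⟩
    · obtain ⟨m, hm, hp⟩ := h1 ⟨a, mem_H_of_mem (v j).2 ha⟩ ha
      exact ⟨m.1, hm, hp⟩
    · have q := of_pair_mem_H (mem_H_of_mem (v i).2 h)
      have q' := of_pair_mem_H (mem_H_of_mem (v i).2 h')
      simpa only [Subtype.mk.injEq] using h2 ⟨m, q.1⟩ ⟨a, q.2⟩ ⟨m', q'.1⟩ ⟨a', q'.2⟩ h h'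

/-- An elementary submodel containing a code of an injection is closed under the injection. -/
theorem IsSub.fst_mem_of_isInjCode {M e x w a m : ZFSet.{u}} (hM : IsSub κ r M)
    (he : IsInjCode e x w) (heM : e ∈ M) (ha : a ∈ M) (h : ZFSet.pair m a ∈ e) : m ∈ M :=
  hM.mem_of_unique (p := fun v y => ZFSet.pair y.1 (v 0).1 ∈ (v 1).1) (IsDef.pair_mem _ _ _)
    ![⟨a, hM.mem_H ha⟩, ⟨e, hM.mem_H heM⟩] (by simp [Fin.forall_fin_two, ha, heM])
    ⟨m, (of_pair_mem_H (mem_H_of_mem (hM.mem_H heM) h)).1⟩ h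
    fun _ hy => Subtype.ext ((he.2 _ _ _ _ hy h).2 rfl)

/-- An elementary submodel containing a code of an injection is closed under its inverse. -/
theorem IsSub.snd_mem_of_isInjCode {M e x w a m : ZFSet.{u}} (hM : IsSub κ r M)
    (he : IsInjCode e x w) (heM : e ∈ M) (hm : m ∈ M) (h : ZFSet.pair m a ∈ e) : a ∈ M :=
  hM.mem_of_unique (p := fun v y => ZFSet.pair (v 0).1 y.1 ∈ (v 1).1) (IsDef.pair_mem _ _ _)
    ![⟨m, hM.mem_H hm⟩, ⟨e, hM.mem_H heM⟩] (by simp [Fin.forall_fin_two, hm, heM])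
    ⟨a, (of_pair_mem_H (mem_H_of_mem (hM.mem_H heM) h)).2⟩ h
    fun _ hy => Subtype.ext ((he.2 _ _ _ _ hy h).1 rfl)

end InjCode

/-! ### Cardinals, countable sets and heights in elementary submodels -/

section Omega

variable {κ : Cardinal.{u}} {r : H κ → H κ → Prop} {M : ZFSet.{u}}

/-- The set `x` contains `∅` and is closed under `t ↦ t ∪ {t}`. -/
def IsInductive (x : ZFSet.{u}) : Prop := ∅ ∈ x ∧ ∀ t ∈ x, insert t t ∈ x

theorem isInductive_omega : IsInductive (ω : Ordinal.{u}).toZFSet := by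
  refine ⟨?_, fun t ht => ?_⟩
  · rw [← Ordinal.toZFSet_zero]
    exact Ordinal.toZFSet_mem_toZFSet_iff.2 Ordinal.omega0_pos
  · obtain ⟨α, hα, rfl⟩ := Ordinal.mem_toZFSet_iff.1 ht
    rw [← Ordinal.toZFSet_add_one]
    exact Ordinal.toZFSet_mem_toZFSet_iff.2 (Ordinal.isSuccLimit_omega0.add_one_lt hα)

theorem IsInductive.natCast_mem {x : ZFSet.{u}} (hx : IsInductive x) (k : ℕ) :
    (k : Ordinal.{u}).toZFSet ∈ x := by
  induction k with
  | zero => simpa using hx.1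
  | succ k ih =>
    rw [Nat.cast_add, Nat.cast_one, Ordinal.toZFSet_add_one]
    exact hx.2 _ ih

theorem IsInductive.omega_subset {x : ZFSet.{u}} (hx : IsInductive x) :
    (ω : Ordinal.{u}).toZFSet ⊆ x := by
  intro t ht
  obtain ⟨α, hα, rfl⟩ := Ordinal.mem_toZFSet_iff.1 ht
  obtain ⟨k, rfl⟩ := Ordinal.lt_omega0.1 hα
  exact hx.natCast_mem k

theorem toZFSet_countable_iff {α : Ordinal.{u}} :
    (α.toZFSet : Set ZFSet.{u}).Countable ↔ α < ω_ 1 := by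
  rw [← Cardinal.le_aleph0_iff_set_countable, card_toZFSet_coe, Cardinal.lift_le_aleph0,
    ← Cardinal.ord_aleph, Cardinal.lt_ord, ← Cardinal.succ_aleph0, Order.lt_succ_iff]

theorem card_omega_coe (α : Ordinal.{u}) :
    #((ω_ α).toZFSet : Set ZFSet.{u}) = Cardinal.lift.{u + 1} (ℵ_ α) := by
  rw [card_toZFSet_coe, Ordinal.card_omega]

theorem omega_mem_H {α : Ordinal.{u}} (h : ℵ_ α < κ) : (ω_ α).toZFSet ∈ H κ :=
  toZFSet_mem_H (by rwa [Ordinal.card_omega])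

theorem aleph0_lt_of_aleph_one_lt (h : ℵ_ 1 < κ) : ℵ_ ((0 : ℕ) : Ordinal.{u}) < κ :=
  (Cardinal.aleph_le_aleph.2 (by simp)).trans_lt h

variable [hκ : Fact κ.IsRegular]

theorem IsDef.isInductive {n : ℕ} (i : Fin n) :
    IsDef r fun v : Fin n → H κ => IsInductive (v i).1 := by
  refine IsDef.congr (p := fun v => (∃ x : H κ, x.1 = ∅ ∧ x.1 ∈ (v i).1) ∧
    ∀ t : H κ, t.1 ∈ (v i).1 → ∃ s : H κ, s.1 = insert t.1 t.1 ∧ s.1 ∈ (v i).1)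
    ((ex ((eq_empty _).and (mem _ _))).and
      (all ((mem _ _).imp (ex ((eq_insert _ _ _).and (mem _ _)))))) fun v => ?_
  constructor
  · exact fun h => ⟨⟨⟨∅, empty_mem_H⟩, rfl, h.1⟩,
      fun t ht => ⟨⟨_, insert_mem_H t.2 t.2⟩, rfl, h.2 _ ht⟩⟩
  · rintro ⟨⟨x, hx, hx'⟩, h⟩
    refine ⟨hx ▸ hx', fun t ht => ?_⟩
    obtain ⟨s, hs, hs'⟩ := h ⟨t, mem_H_of_mem (v i).2 ht⟩ ht
    exact hs ▸ hs'

theorem IsSub.omega_mem (hM : IsSub κ r M) (k : ℕ) (hk : ℵ_ (k : Ordinal.{u}) < κ) :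
    (ω_ (k : Ordinal.{u})).toZFSet ∈ M := by
  induction k with
  | zero =>
    have hH : (ω_ ((0 : ℕ) : Ordinal.{u})).toZFSet ∈ H κ := omega_mem_H hk
    rw [Nat.cast_zero, Ordinal.omega_zero] at hH ⊢
    refine hM.mem_of_unique (n := 0) (p := fun _ y => IsInductive y.1 ∧
      ∀ z : H κ, IsInductive z.1 → y.1 ⊆ z.1)
      ((IsDef.isInductive _).and (IsDef.all ((IsDef.isInductive _).imp (IsDef.subset _ _))))
      ![] (fun i => i.elim0) ⟨_, hH⟩ ⟨isInductive_omega, fun z hz => hz.omega_subset⟩ ?_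
    rintro y ⟨hy, hy'⟩
    exact Subtype.ext (subset_antisymm (hy' ⟨_, hH⟩ isInductive_omega) hy.omega_subset)
  | succ k ih =>
    have hlt : ℵ_ (k : Ordinal.{u}) < κ :=
      (Cardinal.aleph_le_aleph.2 (by exact_mod_cast Nat.le_succ k)).trans_lt hk
    have hkM := ih hlt
    refine hM.mem_of_forall_mem_iff (q := fun v t => t.1.IsOrdinal ∧
      ∃ e : H κ, IsInjCode e.1 t.1 (v 0).1)
      ((IsDef.isOrdinal _).and (IsDef.ex (IsDef.isInjCode _ _ _)))
      ![⟨_, hM.mem_H hkM⟩] (by simp [hkM]) _ (omega_mem_H hk) fun t => ?_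
    have hcard : ∀ β : Ordinal.{u}, β < ω_ ((k + 1 : ℕ) : Ordinal.{u}) ↔
        #(β.toZFSet : Set ZFSet.{u}) ≤ #((ω_ (k : Ordinal.{u})).toZFSet : Set ZFSet.{u}) := by
      intro β
      rw [card_omega_coe, card_toZFSet_coe, Cardinal.lift_le, ← Cardinal.ord_aleph,
        Cardinal.lt_ord, Nat.cast_add, Nat.cast_one, ← Cardinal.succ_aleph, Order.lt_succ_iff]
    constructor
    · intro ht
      obtain ⟨β, hβ, hβt⟩ := Ordinal.mem_toZFSet_iff.1 ht
      refine ⟨hβt ▸ ZFSet.isOrdinal_toZFSet β, ?_⟩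
      exact exists_isInjCode t.2 (omega_mem_H hlt) (hβt ▸ (hcard β).1 hβ)
    · rintro ⟨ho, e, he⟩
      obtain ⟨β, hβ⟩ := ZFSet.isOrdinal_iff_mem_range_toZFSet.1 ho
      have := he.card_le
      rw [← hβ] at this ⊢
      exact Ordinal.toZFSet_mem_toZFSet_iff.2 ((hcard β).2 this)

/-- Countable elements of an elementary submodel are subsets of it. -/
theorem IsSub.subset_of_countable (hM : IsSub κ r M) (h1 : ℵ_ 1 < κ) {A : ZFSet.{u}}
    (hA : A ∈ M) (hc : (A : Set ZFSet.{u}).Countable) : A ⊆ M := by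
  have h0 := aleph0_lt_of_aleph_one_lt h1
  have hω := hM.omega_mem 0 h0
  have hle : #(A : Set ZFSet.{u}) ≤ #((ω_ ((0 : ℕ) : Ordinal.{u})).toZFSet : Set ZFSet.{u}) := by
    rw [card_omega_coe]
    simpa using hc.le_aleph0
  obtain ⟨e, heM, he⟩ := hM.exists_mem (p := fun v e => IsInjCode e.1 (v 0).1 (v 1).1)
    (IsDef.isInjCode _ _ _) ![⟨A, hM.mem_H hA⟩, ⟨_, hM.mem_H hω⟩]
    (by simpa [Fin.forall_fin_two, hA] using hω)
    (exists_isInjCode (hM.mem_H hA) (hM.mem_H hω) hle)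
  intro a ha
  obtain ⟨m, hm, hma⟩ := he.1 a ha
  obtain ⟨α, hα, rfl⟩ := Ordinal.mem_toZFSet_iff.1 hm
  rw [Nat.cast_zero, Ordinal.omega_zero] at hα
  obtain ⟨k, rfl⟩ := Ordinal.lt_omega0.1 hα
  have hind : IsInductive M := ⟨hM.empty_mem, fun t ht => hM.insert_mem ht ht⟩
  exact hM.snd_mem_of_isInjCode he heM (hind.natCast_mem k) hma

theorem IsSub.inter_omega_one (hM : IsSub κ r M) (h1 : ℵ_ 1 < κ) :
    M ∩ (ω_ 1).toZFSet = (height M).toZFSet := by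
  have ho : ZFSet.IsOrdinal (M ∩ (ω_ 1).toZFSet) := by
    have hω := ZFSet.isOrdinal_toZFSet (ω_ 1 : Ordinal.{u})
    refine ⟨fun y hy z hz => ?_, fun {x y z} hx hy hz => ?_⟩
    · obtain ⟨hyM, hyω⟩ := ZFSet.mem_inter.1 hy
      obtain ⟨α, hα, rfl⟩ := Ordinal.mem_toZFSet_iff.1 hyω
      exact ZFSet.mem_inter.2 ⟨hM.subset_of_countable h1 hyM (toZFSet_countable_iff.2 hα) hz,
        hω.mem_trans hz hyω⟩
    · exact (hω.mem (ZFSet.mem_inter.1 hz).2).mem_trans hx hy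
  exact (ho.toZFSet_rank_eq).symm

theorem IsSub.height_lt (hM : IsSub κ r M) (h1 : ℵ_ 1 < κ) : height M < ω_ 1 := by
  rw [← toZFSet_countable_iff, ← hM.inter_omega_one h1, ZFSet.coe_inter]
  exact hM.1.mono Set.inter_subset_left

theorem IsSub.mem_of_lt_height (hM : IsSub κ r M) (h1 : ℵ_ 1 < κ) {α : Ordinal.{u}}
    (h : α < height M) : α.toZFSet ∈ M := by
  have := Ordinal.toZFSet_mem_toZFSet_iff.2 h
  rw [← hM.inter_omega_one h1] at this
  exact (ZFSet.mem_inter.1 this).1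

theorem IsSub.lt_height (hM : IsSub κ r M) (h1 : ℵ_ 1 < κ) {α : Ordinal.{u}}
    (hα : α < ω_ 1) (h : α.toZFSet ∈ M) : α < height M := by
  rw [← Ordinal.toZFSet_mem_toZFSet_iff, ← hM.inter_omega_one h1]
  exact ZFSet.mem_inter.2 ⟨h, Ordinal.toZFSet_mem_toZFSet_iff.2 hα⟩

end Omega

/-! ### Order types of countable sets of ordinals -/

theorem le_of_strictMonoOn_Iio {f : Ordinal.{u} → Ordinal.{u}} {a b : Ordinal.{u}}
    (hf : StrictMonoOn f (Set.Iio a)) (hb : ∀ x < a, f x < b) : a ≤ b := by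
  have key : ∀ x, x < a → x ≤ f x := by
    intro x
    induction x using WellFoundedLT.induction with
    | ind x ih =>
      intro hx
      refine le_of_forall_lt fun y hy => ?_
      exact (ih y hy (hy.trans hx)).trans_lt (hf (hy.trans hx) hx hy)
  by_contra! h
  exact ((key b h).trans_lt (hb b h)).false

/-- A countable set of ordinals embeds increasingly into a countable ordinal. -/
theorem exists_increasing_lt_omega_one (A : ZFSet.{u}) (hA : (A : Set ZFSet.{u}).Countable) :
    ∃ c : ZFSet.{u} → Ordinal.{u}, ∃ η < ω_ 1, (∀ a ∈ A, c a < η) ∧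
      ∀ a ∈ A, ∀ b ∈ A, a ∈ b → c a < c b := by
  classical
  -- Shrinking `A` makes the ranks of its elements ordinals of the universe `u`.
  let S := Shrink.{u} A
  let e : A ≃ S := equivShrink _
  have : Countable A := hA.to_subtype
  have : Countable S := e.symm.injective.countable
  let R : S → S → Prop := fun s t => (e.symm s).1 ∈ (e.symm t).1
  have : IsWellFounded S R := ⟨InvImage.wf (fun s => (e.symm s).1) ZFSet.mem_wf⟩
  have hrank : ∀ s : S, IsWellFounded.rank R s < ω_ 1 := by
    intro s
    induction s using IsWellFounded.induction R with
    | _ s ih =>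
      rw [IsWellFounded.rank_eq]
      exact Ordinal.iSup_lt_omega_one fun b => (Cardinal.isSuccLimit_omega 1).succ_lt (ih b.1 b.2)
  refine ⟨fun a => if h : a ∈ A then IsWellFounded.rank R (e ⟨a, h⟩) else 0,
    ⨆ s : S, Order.succ (IsWellFounded.rank R s), Ordinal.iSup_lt_omega_one fun s =>
      (Cardinal.isSuccLimit_omega 1).succ_lt (hrank s), fun a ha => ?_, fun a ha b hb hab => ?_⟩
  · simp only [dif_pos ha]
    exact Order.succ_le_iff.1
      (Ordinal.le_iSup (fun s : S => Order.succ (IsWellFounded.rank R s)) (e ⟨a, ha⟩))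
  · simp only [dif_pos ha, dif_pos hb]
    refine IsWellFounded.rank_lt_of_rel ?_
    simpa [R] using hab

section Lex

variable {κ : Cardinal.{u}} {r : H κ → H κ → Prop} {M : ZFSet.{u}}

theorem countable_card_lt (h1 : ℵ_ 1 < κ) {s : Set ZFSet.{u}} (hs : s.Countable) :
    #s < Cardinal.lift.{u + 1} κ :=
  hs.le_aleph0.trans_lt (Cardinal.aleph0_lt_lift.2
    ((Cardinal.aleph0_le_aleph 1).trans_lt h1))

variable [hκ : Fact κ.IsRegular]

/-- If `A, B ∈ M` are countable sets of ordinals, then `A × B`, ordered lexicographically, embeds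
increasingly into an ordinal below `δ_M`. -/
theorem IsSub.exists_lex_increasing (hM : IsSub κ r M) (h1 : ℵ_ 1 < κ) {A B : ZFSet.{u}}
    (hA : A ∈ M) (hB : B ∈ M) (hAc : (A : Set ZFSet.{u}).Countable)
    (hBc : (B : Set ZFSet.{u}).Countable) :
    ∃ F : ZFSet.{u} → ZFSet.{u} → Ordinal.{u}, ∃ η < height M,
      (∀ a ∈ A, ∀ b ∈ B, F a b < η) ∧
      ∀ a ∈ A, ∀ b ∈ B, ∀ a' ∈ A, ∀ b' ∈ B, (a ∈ a' ∨ a = a' ∧ b ∈ b') → F a b < F a' b' := by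
  have hω1 : (ω_ (1 : Ordinal.{u})).toZFSet ∈ M := by
    simpa using hM.omega_mem 1 (by simpa using h1)
  obtain ⟨cA, α, hα, hcA, hcA'⟩ := exists_increasing_lt_omega_one A hAc
  obtain ⟨cB, β, hβ, hcB, hcB'⟩ := exists_increasing_lt_omega_one B hBc
  have hlex : ∀ a ∈ A, ∀ b ∈ B, ∀ a' ∈ A, ∀ b' ∈ B, (a ∈ a' ∨ a = a' ∧ b ∈ b') →
      β * cA a + cB b < β * cA a' + cB b' := by
    rintro a ha b hb a' ha' b' hb' (h | ⟨rfl, h⟩)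
    · calc β * cA a + cB b < β * cA a + β := by gcongr; exact hcB b hb
        _ = β * (cA a + 1) := (mul_add_one _ _).symm
        _ ≤ β * cA a' := by
          gcongr
          exact Order.add_one_le_of_lt (hcA' a ha a' ha' h)
        _ ≤ _ := le_self_add
    · gcongr
      exact hcB' b hb b' hb' h
  have hlt : ∀ a ∈ A, ∀ b ∈ B, β * cA a + cB b < β * α := by
    intro a ha b hb
    calc β * cA a + cB b < β * cA a + β := by gcongr; exact hcB b hb
      _ = β * (cA a + 1) := (mul_add_one _ _).symm
      _ ≤ β * α := by
        gcongr
        exact Order.add_one_le_of_lt (hcA a ha)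
  have hprod : β * α < ω_ 1 := by
    rw [← Cardinal.ord_aleph, Cardinal.lt_ord, ← Cardinal.succ_aleph0, Order.lt_succ_iff] at *
    rw [Ordinal.card_mul]
    exact (mul_le_mul' hβ hα).trans_eq Cardinal.aleph0_mul_aleph0
  have hcH : ∀ γ : Ordinal.{u}, γ < ω_ 1 → γ.toZFSet ∈ H κ := fun γ hγ =>
    mem_H_of_mem (hM.mem_H hω1) (Ordinal.toZFSet_mem_toZFSet_iff.2 hγ)
  -- The code of the increasing map, a set of triples.
  obtain ⟨f, hf⟩ := exists_H_eq (κ := κ)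
    (s := Set.image2 (fun a b => ZFSet.pair (ZFSet.pair a b) (β * cA a + cB b).toZFSet) A B) (by
      rintro _ ⟨a, ha, b, hb, rfl⟩
      exact pair_mem_H (pair_mem_H (mem_H_of_mem (hM.mem_H hA) ha) (mem_H_of_mem (hM.mem_H hB) hb))
        (hcH _ ((hlt a ha b hb).trans hprod)))
    (countable_card_lt h1 (hAc.image2 hBc _))
  have htriple : ∀ a b c, ZFSet.pair (ZFSet.pair a b) c ∈ f.1 ↔
      a ∈ A ∧ b ∈ B ∧ (β * cA a + cB b).toZFSet = c := by
    intro a b c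
    rw [hf, Set.mem_image2]
    constructor
    · rintro ⟨a', ha, b', hb, h⟩
      obtain ⟨hab, hc⟩ := ZFSet.pair_inj.1 h
      obtain ⟨rfl, rfl⟩ := ZFSet.pair_inj.1 hab
      exact ⟨ha, hb, hc⟩
    · rintro ⟨ha, hb, rfl⟩
      exact ⟨a, ha, b, hb, rfl⟩
  obtain ⟨y, hyM, hyω, g, hg, hg'⟩ := hM.exists_mem (p := fun v y => y.1 ∈ (v 0).1 ∧ ∃ f : H κ,
      (∀ a : H κ, a.1 ∈ (v 1).1 → ∀ b : H κ, b.1 ∈ (v 2).1 → ∃ c : H κ, c.1 ∈ y.1 ∧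
        ZFSet.pair (ZFSet.pair a.1 b.1) c.1 ∈ f.1) ∧
      ∀ a b a' b' c c' : H κ, ZFSet.pair (ZFSet.pair a.1 b.1) c.1 ∈ f.1 →
        ZFSet.pair (ZFSet.pair a'.1 b'.1) c'.1 ∈ f.1 → (a.1 ∈ a'.1 ∨ a = a' ∧ b.1 ∈ b'.1) →
        c.1 ∈ c'.1)
    ((IsDef.mem _ _).and (IsDef.ex ((IsDef.all ((IsDef.mem _ _).imp (IsDef.all ((IsDef.mem _ _).imp
      (IsDef.ex ((IsDef.mem _ _).and (IsDef.triple_mem _ _ _ _))))))).and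
      (IsDef.all (IsDef.all (IsDef.all (IsDef.all (IsDef.all (IsDef.all
        ((IsDef.triple_mem _ _ _ _).imp ((IsDef.triple_mem _ _ _ _).imp
          (((IsDef.mem _ _).or ((IsDef.eq _ _).and (IsDef.mem _ _))).imp
            (IsDef.mem _ _)))))))))))))
    ![⟨_, hM.mem_H hω1⟩, ⟨A, hM.mem_H hA⟩, ⟨B, hM.mem_H hB⟩]
    (by
      intro i
      fin_cases i
      exacts [hω1, hA, hB])
    ⟨⟨_, hcH _ hprod⟩, Ordinal.toZFSet_mem_toZFSet_iff.2 hprod, f, fun a ha b hb =>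
      ⟨⟨_, hcH _ ((hlt a ha b hb).trans hprod)⟩,
        Ordinal.toZFSet_mem_toZFSet_iff.2 (hlt a ha b hb), (htriple _ _ _).2 ⟨ha, hb, rfl⟩⟩, by
      intro a b a' b' c c' h h' hl
      obtain ⟨ha, hb, hc⟩ := (htriple _ _ _).1 h
      obtain ⟨ha', hb', hc'⟩ := (htriple _ _ _).1 h'
      rw [← hc, ← hc', Ordinal.toZFSet_mem_toZFSet_iff]
      exact hlex _ ha _ hb _ ha' _ hb' (hl.imp_right fun h => ⟨congrArg Subtype.val h.1, h.2⟩)⟩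
  obtain ⟨η, hη, hηy⟩ := Ordinal.mem_toZFSet_iff.1 hyω
  have hex : ∀ a ∈ A, ∀ b ∈ B, ∃ c : Ordinal.{u}, c < η ∧
      ZFSet.pair (ZFSet.pair a b) c.toZFSet ∈ g.1 := by
    intro a ha b hb
    obtain ⟨c, hc, hcg⟩ := hg ⟨a, mem_H_of_mem (hM.mem_H hA) ha⟩ ha
      ⟨b, mem_H_of_mem (hM.mem_H hB) hb⟩ hb
    rw [← hηy] at hc
    obtain ⟨γ, hγ, hγc⟩ := Ordinal.mem_toZFSet_iff.1 hc
    exact ⟨γ, hγ, hγc ▸ hcg⟩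
  classical
  choose F hF hFg using hex
  refine ⟨fun a b => if h : a ∈ A ∧ b ∈ B then F a h.1 b h.2 else 0, η,
    hM.lt_height h1 hη (hηy ▸ hyM), fun a ha b hb => ?_, fun a ha b hb a' ha' b' hb' h => ?_⟩
  · simpa only [dif_pos (And.intro ha hb)] using hF a ha b hb
  · simp only [dif_pos (And.intro ha hb), dif_pos (And.intro ha' hb')]
    rw [← Ordinal.toZFSet_mem_toZFSet_iff]
    have q := of_pair_mem_H (mem_H_of_mem g.2 (hFg a ha b hb))
    have q' := of_pair_mem_H (mem_H_of_mem g.2 (hFg a' ha' b' hb'))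
    have s := of_pair_mem_H q.1
    have s' := of_pair_mem_H q'.1
    exact hg' ⟨a, s.1⟩ ⟨b, s.2⟩ ⟨a', s'.1⟩ ⟨b', s'.2⟩ ⟨_, q.2⟩ ⟨_, q'.2⟩ (hFg a ha b hb)
      (hFg a' ha' b' hb') (h.imp_right fun h => ⟨Subtype.ext h.1, h.2⟩)

theorem IsSub.exists_increasing (hM : IsSub κ r M) (h1 : ℵ_ 1 < κ) {A : ZFSet.{u}}
    (hA : A ∈ M) (hAc : (A : Set ZFSet.{u}).Countable) :
    ∃ f : ZFSet.{u} → Ordinal.{u}, (∀ a ∈ A, f a < height M) ∧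
      ∀ a ∈ A, ∀ b ∈ A, a ∈ b → f a < f b := by
  have h0 : ({∅} : ZFSet.{u}) ∈ M := by
    rw [← insert_empty_eq]
    exact hM.insert_mem hM.empty_mem hM.empty_mem
  obtain ⟨F, η, hη, hF, hF'⟩ := hM.exists_lex_increasing h1 hA h0 hAc (by simp)
  exact ⟨fun a => F a ∅, fun a ha => (hF a ha ∅ (by simp)).trans hη,
    fun a ha b hb h => hF' a ha ∅ (by simp) b hb ∅ (by simp) (Or.inl h)⟩

/-- For `α, β < δ_M`, the product `α * β` is the order type of `β × α` in the lexicographic order,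
and this embeds increasingly into an ordinal below `δ_M`. -/
theorem IsSub.isPrincipal_mul_height (hM : IsSub κ r M) (h1 : ℵ_ 1 < κ) :
    Ordinal.IsPrincipal (· * ·) (height M) := by
  intro α β hα hβ
  have hc : ∀ γ < height M, (γ.toZFSet : Set ZFSet.{u}).Countable := fun γ hγ =>
    toZFSet_countable_iff.2 (hγ.trans (hM.height_lt h1))
  obtain ⟨F, η, hη, hF, hF'⟩ := hM.exists_lex_increasing h1 (hM.mem_of_lt_height h1 hβ)
    (hM.mem_of_lt_height h1 hα) (hc β hβ) (hc α hα)
  rcases eq_or_ne α 0 with rfl | hα0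
  · simpa using hα
  have hdiv : ∀ ξ < α * β, (ξ / α).toZFSet ∈ β.toZFSet := fun ξ hξ =>
    Ordinal.toZFSet_mem_toZFSet_iff.2 ((Ordinal.lt_mul_iff_div_lt hα0).1 hξ)
  have hmod : ∀ ξ, (ξ % α).toZFSet ∈ α.toZFSet := fun ξ =>
    Ordinal.toZFSet_mem_toZFSet_iff.2 (Ordinal.mod_lt ξ hα0)
  refine (le_of_strictMonoOn_Iio (f := fun ξ => F (ξ / α).toZFSet (ξ % α).toZFSet) ?_ ?_).trans_lt
    hη
  · intro ξ hξ ξ' hξ' hlt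
    refine hF' _ (hdiv ξ hξ) _ (hmod ξ) _ (hdiv ξ' hξ') _ (hmod ξ') ?_
    simp only [Ordinal.toZFSet_mem_toZFSet_iff, Ordinal.toZFSet_injective.eq_iff]
    rcases lt_trichotomy (ξ / α) (ξ' / α) with h | h | h
    · exact Or.inl h
    · refine Or.inr ⟨h, ?_⟩
      rw [← Ordinal.div_add_mod ξ α, ← Ordinal.div_add_mod ξ' α, h] at hlt
      exact (add_lt_add_iff_left _).1 hlt
    · exact absurd h (Ordinal.div_le_left hlt.le α).not_gt
  · exact fun ξ hξ => hF _ (hdiv ξ hξ) _ (hmod ξ)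

end Lex

/-- If `δ` is closed under ordinal multiplication, then `δ` is not, even on a tail, the union of
finitely many sets that embed increasingly into ordinals below `δ`. -/
theorem exists_notMem_of_isPrincipal_mul {δ : Ordinal.{u}} (hδ : Ordinal.IsPrincipal (· * ·) δ)
    (h2 : 2 < δ) {ι : Type*} [Finite ι] (B : ι → Set Ordinal.{u}) (o : ι → Ordinal.{u})
    (ho : ∀ i, o i < δ) (f : ι → Ordinal.{u} → Ordinal.{u})
    (hf : ∀ i, StrictMonoOn (f i) (B i)) (hfo : ∀ i, ∀ b ∈ B i, f i b < o i)
    {x : Ordinal.{u}} (hx : x < δ) : ∃ α, x ≤ α ∧ α < δ ∧ ∀ i, α ∉ B i := by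
  classical
  have hadd : Ordinal.IsPrincipal (· + ·) δ :=
    Ordinal.isPrincipal_add_of_isPrincipal_mul hδ h2.ne'
  have h1 : 1 < δ := lt_trans (by exact_mod_cast Nat.one_lt_two) h2
  have key : ∀ s : Finset ι, ∃ τ < δ, ∀ x, ∃ α, x ≤ α ∧ α < x + τ ∧ ∀ i ∈ s, α ∉ B i := by
    intro s
    induction s using Finset.induction_on with
    | empty => exact ⟨1, h1, fun x => ⟨x, le_rfl, by simp, by simp⟩⟩
    | insert j s _ ih =>
      obtain ⟨τ, hτ, hτ'⟩ := ih
      -- Every block of length `τ` has a point outside the other sets; `o j + 1` such points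
      -- cannot all lie in `B j`.
      refine ⟨τ * (o j + 1), hδ hτ (hadd (ho j) h1), fun x => ?_⟩
      by_contra! hcon
      choose g hg1 hg2 hg3 using fun ξ => hτ' (x + τ * ξ)
      have hblock : ∀ ξ ξ', ξ < ξ' → x + τ * ξ + τ ≤ x + τ * ξ' := by
        intro ξ ξ' h
        rw [add_assoc, ← mul_add_one]
        gcongr
        exact Order.add_one_le_of_lt h
      have hgB : ∀ ξ < o j + 1, g ξ ∈ B j := by
        intro ξ hξ
        obtain ⟨i, hi, hiB⟩ := hcon (g ξ) (le_self_add.trans (hg1 ξ))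
          ((hg2 ξ).trans_le (hblock ξ _ hξ))
        rcases Finset.mem_insert.1 hi with rfl | hi
        · exact hiB
        · exact absurd hiB (hg3 ξ i hi)
      have hle : o j + 1 ≤ o j := le_of_strictMonoOn_Iio (f := fun ξ => f j (g ξ))
        (fun ξ hξ ξ' hξ' h => hf j (hgB ξ hξ) (hgB ξ' hξ')
          (((hg2 ξ).trans_le (hblock ξ ξ' h)).trans_le (hg1 ξ')))
        fun ξ hξ => hfo j _ (hgB ξ hξ)
      exact (Order.lt_add_one_iff.2 le_rfl).not_ge hle
  cases nonempty_fintype ι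
  obtain ⟨τ, hτ, h⟩ := key Finset.univ
  obtain ⟨α, hα, hα', hB⟩ := h x
  exact ⟨α, hα, hα'.trans (hadd hx hτ), fun i => hB i (Finset.mem_univ i)⟩

/-! ### Strict suprema of countable sets of ordinals -/

/-- The strict supremum `⋃_{z ∈ Z} (z + 1)` of a set `Z` of von Neumann ordinals. -/
noncomputable def ssup (Z : ZFSet.{u}) : ZFSet.{u} := Z ∪ ZFSet.sUnion Z

section Ssup

theorem mem_ssup {Z t : ZFSet.{u}} : t ∈ ssup Z ↔ ∃ z ∈ Z, t = z ∨ t ∈ z := by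
  simp only [ssup, ZFSet.mem_union, ZFSet.mem_sUnion]
  constructor
  · rintro (h | ⟨z, hz, h⟩)
    · exact ⟨t, h, Or.inl rfl⟩
    · exact ⟨z, hz, Or.inr h⟩
  · rintro ⟨z, hz, rfl | h⟩
    · exact Or.inl hz
    · exact Or.inr ⟨z, hz, h⟩

theorem subset_ssup (Z : ZFSet.{u}) : Z ⊆ ssup Z := fun z hz => mem_ssup.2 ⟨z, hz, Or.inl rfl⟩

theorem ssup_mono {Z Z' : ZFSet.{u}} (h : Z ⊆ Z') : ssup Z ⊆ ssup Z' := fun t ht => by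
  obtain ⟨z, hz, ht⟩ := mem_ssup.1 ht
  exact mem_ssup.2 ⟨z, h hz, ht⟩

theorem isOrdinal_ssup {Z : ZFSet.{u}} (hZ : ∀ z ∈ Z, z.IsOrdinal) : (ssup Z).IsOrdinal := by
  refine ZFSet.isOrdinal_iff_forall_mem_isOrdinal.2 ⟨fun t ht s hs => ?_, fun t ht => ?_⟩
  · obtain ⟨z, hz, rfl | ht⟩ := mem_ssup.1 ht
    · exact mem_ssup.2 ⟨_, hz, Or.inr hs⟩
    · exact mem_ssup.2 ⟨z, hz, Or.inr ((hZ z hz).mem_trans hs ht)⟩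
  · obtain ⟨z, hz, rfl | ht⟩ := mem_ssup.1 ht
    · exact hZ _ hz
    · exact (hZ z hz).mem ht

theorem isOrdinal_of_mem_toZFSet {α : Ordinal.{u}} {x : ZFSet.{u}} (h : x ∈ α.toZFSet) :
    x.IsOrdinal := (ZFSet.isOrdinal_toZFSet α).mem h

theorem card_lt_aleph_of_mem {x : ZFSet.{u}} {o : Ordinal.{u}} (h : x ∈ (ω_ o).toZFSet) :
    #(x : Set ZFSet.{u}) < Cardinal.lift.{u + 1} (ℵ_ o) := by
  obtain ⟨β, hβ, rfl⟩ := Ordinal.mem_toZFSet_iff.1 h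
  rwa [card_toZFSet_coe, Cardinal.lift_lt, ← Cardinal.lt_ord, Cardinal.ord_aleph]

/-- The cardinals `ω_{k+1}` have uncountable cofinality. -/
theorem ssup_mem_omega {k : ℕ} {Z : ZFSet.{u}} (hZ : (Z : Set ZFSet.{u}).Countable)
    (hZω : Z ⊆ (ω_ ((k + 1 : ℕ) : Ordinal.{u})).toZFSet) :
    ssup Z ∈ (ω_ ((k + 1 : ℕ) : Ordinal.{u})).toZFSet := by
  have hreg : (Cardinal.lift.{u + 1} (ℵ_ ((k + 1 : ℕ) : Ordinal.{u}))).IsRegular := by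
    rw [Nat.cast_add, Nat.cast_one]
    exact (Cardinal.isRegular_aleph_add_one _).lift
  have hZlt : #(Z : Set ZFSet.{u}) < Cardinal.lift.{u + 1} (ℵ_ ((k + 1 : ℕ) : Ordinal.{u})) := by
    refine hZ.le_aleph0.trans_lt (Cardinal.aleph0_lt_lift.2 ?_)
    rw [← Cardinal.aleph_zero, Cardinal.aleph_lt_aleph]
    exact_mod_cast Nat.succ_pos k
  have hlt : #(ssup Z : Set ZFSet.{u}) < Cardinal.lift.{u + 1} (ℵ_ ((k + 1 : ℕ) : Ordinal.{u})) := by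
    refine lt_of_le_of_lt (Cardinal.mk_le_mk_of_subset (t := (Z : Set ZFSet.{u}) ∪
      ⋃ z ∈ (Z : Set ZFSet.{u}), (z : Set ZFSet.{u})) fun t ht => ?_)
      ((Cardinal.mk_union_le _ _).trans_lt (Cardinal.add_lt_of_lt hreg.aleph0_le hZlt
        ((card_biUnion_lt_iff_forall_of_isRegular hreg hZlt).2
          fun z hz => card_lt_aleph_of_mem (hZω hz))))
    obtain ⟨z, hz, rfl | ht⟩ := mem_ssup.1 ht
    · exact Or.inl hz
    · exact Or.inr (Set.mem_biUnion hz ht)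
  obtain ⟨β, hβ⟩ := ZFSet.isOrdinal_iff_mem_range_toZFSet.1
    (isOrdinal_ssup fun z hz => isOrdinal_of_mem_toZFSet (hZω hz))
  rw [← hβ, card_toZFSet_coe, Cardinal.lift_lt, ← Cardinal.lt_ord, Cardinal.ord_aleph] at hlt
  rw [← hβ]
  exact Ordinal.toZFSet_mem_toZFSet_iff.2 hlt

variable {κ : Cardinal.{u}} {r : H κ → H κ → Prop} {M : ZFSet.{u}} [hκ : Fact κ.IsRegular]

theorem IsSub.ssup_mem (hM : IsSub κ r M) {C : ZFSet.{u}} (hC : C ∈ M) : ssup C ∈ M := by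
  have hCH := hM.mem_H hC
  have hH : ssup C ∈ H κ := by
    refine mem_H_of_subset (fun t ht => ?_)
      (lt_of_le_of_lt (Cardinal.mk_le_mk_of_subset fun t ht => ?_) hCH)
    · obtain ⟨z, hz, rfl | ht⟩ := mem_ssup.1 ht
      · exact mem_H_of_mem hCH hz
      · exact mem_H_of_mem (mem_H_of_mem hCH hz) ht
    · obtain ⟨z, hz, rfl | ht⟩ := mem_ssup.1 ht
      · exact Relation.TransGen.single hz
      · exact Relation.TransGen.head (r := fun a b : ZFSet.{u} => a ∈ b) ht
          (Relation.TransGen.single hz)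
  refine hM.mem_of_forall_mem_iff (q := fun v t => ∃ z : H κ, z.1 ∈ (v 0).1 ∧ (t = z ∨ t.1 ∈ z.1))
    (IsDef.ex ((IsDef.mem _ _).and ((IsDef.eq _ _).or (IsDef.mem _ _))))
    ![⟨C, hCH⟩] (by simp [hC]) _ hH fun t => ?_
  rw [mem_ssup]
  constructor
  · rintro ⟨z, hz, h⟩
    exact ⟨⟨z, mem_H_of_mem hCH hz⟩, hz, h.imp_left Subtype.ext⟩
  · rintro ⟨z, hz, h⟩
    exact ⟨z.1, hz, h.imp_left (congrArg Subtype.val)⟩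

/-- If `C ∈ M` is a countable set of ordinals, then `M` contains the strict supremum of every
subset `Z` of `C`, because it is the strict supremum of an initial segment of `C`. -/
theorem IsSub.ssup_mem_of_subset (hM : IsSub κ r M) (h1 : ℵ_ 1 < κ) {C Z : ZFSet.{u}}
    (hC : C ∈ M) (hCc : (C : Set ZFSet.{u}).Countable) (hCo : ∀ c ∈ C, c.IsOrdinal)
    (hZ : Z ⊆ C) : ssup Z ∈ M := by
  have ho : (ssup Z).IsOrdinal := isOrdinal_ssup fun z hz => hCo z (hZ hz)
  by_cases h : ∃ c ∈ C, c ∉ ssup Z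
  · let c := ZFSet.mem_wf.min {c | c ∈ C ∧ c ∉ ssup Z} h
    have hc : c ∈ C ∧ c ∉ ssup Z := ZFSet.mem_wf.min_mem {c | c ∈ C ∧ c ∉ ssup Z} h
    have hmin : ∀ d ∈ C, d ∈ c → d ∈ ssup Z := fun d hd hdc => by
      by_contra hcon
      exact ZFSet.mem_wf.not_lt_min {c | c ∈ C ∧ c ∉ ssup Z} ⟨hd, hcon⟩ hdc
    have hcM : c ∈ M := hM.subset_of_countable h1 hC hCc hc.1
    have heq : ssup Z = ssup (C ∩ c) := by
      refine subset_antisymm (ssup_mono fun z hz => ZFSet.mem_inter.2 ⟨hZ hz, ?_⟩) fun t ht => ?_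
      · exact ((hCo c hc.1).notMem_iff_subset ho).1 hc.2 (subset_ssup Z hz)
      · obtain ⟨z, hz, ht⟩ := mem_ssup.1 ht
        obtain ⟨hzC, hzc⟩ := ZFSet.mem_inter.1 hz
        rcases ht with rfl | ht
        · exact hmin _ hzC hzc
        · exact ho.mem_trans ht (hmin z hzC hzc)
    rw [heq]
    exact hM.ssup_mem (hM.inter_mem hC hcM)
  · push Not at h
    have heq : ssup Z = ssup C := by
      refine subset_antisymm (ssup_mono hZ) fun t ht => ?_
      obtain ⟨z, hz, rfl | ht⟩ := mem_ssup.1 ht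
      · exact h _ hz
      · exact ho.mem_trans ht (h z hz)
    rw [heq]
    exact hM.ssup_mem hC

end Ssup

/-! ### The continuum hypothesis and countable subsets of `ω₁` -/

section CH

variable {κ : Cardinal.{u}} {r : H κ → H κ → Prop} [hκ : Fact κ.IsRegular]

theorem card_countable_subsets_le (CH : (Cardinal.continuum.{u}) = ℵ_ 1) :
    #{t : ZFSet.{u} | t ⊆ (ω_ 1).toZFSet ∧ (t : Set ZFSet.{u}).Countable} ≤
      Cardinal.lift.{u + 1} (ℵ_ 1 : Cardinal.{u}) := by
  let W : Set ZFSet.{u} := ((ω_ 1).toZFSet : ZFSet.{u})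
  have hW : #W = Cardinal.continuum.{u + 1} := by
    rw [← Cardinal.lift_continuum.{u + 1, u}, CH]
    exact card_omega_coe 1
  -- The bound is `ℵ₁ ^ ℵ₀ = (2 ^ ℵ₀) ^ ℵ₀ = 2 ^ ℵ₀ = ℵ₁`.
  have hle : #{t : ZFSet.{u} | t ⊆ (ω_ 1).toZFSet ∧ (t : Set ZFSet.{u}).Countable} ≤
      #{t : Set W // #t ≤ ℵ₀} := by
    refine Cardinal.mk_le_of_injective (f := fun t => ⟨(↑) ⁻¹' (t.1 : Set ZFSet.{u}), ?_⟩) ?_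
    · exact (t.2.2.preimage Subtype.val_injective).le_aleph0
    · rintro ⟨s, hs⟩ ⟨t, ht⟩ hst
      have hst : ((↑) : W → ZFSet.{u}) ⁻¹' (s : Set ZFSet.{u}) = (↑) ⁻¹' (t : Set ZFSet.{u}) :=
        congrArg Subtype.val hst
      refine Subtype.ext (ZFSet.ext fun z => ⟨fun hz => ?_, fun hz => ?_⟩)
      · exact (Set.ext_iff.1 hst ⟨z, hs.1 hz⟩).1 hz
      · exact (Set.ext_iff.1 hst ⟨z, ht.1 hz⟩).2 hz
  refine hle.trans ((Cardinal.mk_bounded_set_le W ℵ₀).trans ?_)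
  rw [hW, max_eq_left Cardinal.aleph0_le_continuum, Cardinal.continuum_power_aleph0, ← CH,
    Cardinal.lift_continuum]

/-- Under CH, the countable subsets of `ω₁` that belong to a model `M` depend only on `δ_M`, and
increasingly so. -/
theorem IsSub.mem_of_subset_omega_one (CH : (Cardinal.continuum.{u}) = ℵ_ 1)
    (hr : IsWellOrder (H κ) r) (h1 : ℵ_ 1 < κ) {M L A : ZFSet.{u}} (hM : IsSub κ r M)
    (hL : IsSub κ r L) (hδ : height M ≤ height L) (hA : A ∈ M) (hAω : A ⊆ (ω_ 1).toZFSet)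
    (hAc : (A : Set ZFSet.{u}).Countable) : A ∈ L := by
  have h0 := aleph0_lt_of_aleph_one_lt h1
  have hω1 : (ω_ (1 : Ordinal.{u})).toZFSet ∈ H κ := omega_mem_H h1
  have hω0 : (ω_ ((0 : ℕ) : Ordinal.{u})).toZFSet ∈ H κ := omega_mem_H h0
  have hmem1 : ∀ K, IsSub κ r K → (ω_ (1 : Ordinal.{u})).toZFSet ∈ K := fun K hK => by
    simpa using hK.omega_mem 1 (by simpa using h1)
  obtain ⟨S, hS⟩ := exists_H_eq (κ := κ)
    (s := {t : ZFSet.{u} | t ⊆ (ω_ 1).toZFSet ∧ (t : Set ZFSet.{u}).Countable})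
    (fun t ht => subset_mem_H hω1 ht.1)
    ((card_countable_subsets_le CH).trans_lt (Cardinal.lift_lt.2 h1))
  have hle : ∀ t : ZFSet.{u}, (t : Set ZFSet.{u}).Countable ↔
      #(t : Set ZFSet.{u}) ≤ #((ω_ ((0 : ℕ) : Ordinal.{u})).toZFSet : Set ZFSet.{u}) := fun t => by
    rw [card_omega_coe, ← Cardinal.le_aleph0_iff_set_countable]
    simp
  have hSmem : ∀ K, IsSub κ r K → S.1 ∈ K := fun K hK => by
    refine hK.mem_of_forall_mem_iff (q := fun v t => t.1 ⊆ (v 0).1 ∧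
      ∃ e : H κ, IsInjCode e.1 t.1 (v 1).1)
      ((IsDef.subset _ _).and (IsDef.ex (IsDef.isInjCode _ _ _)))
      ![⟨_, hω1⟩, ⟨_, hω0⟩]
      (fun i => by
        fin_cases i
        exacts [hmem1 K hK, hK.omega_mem 0 h0]) _ S.2 fun t => ?_
    rw [hS]
    refine and_congr Iff.rfl ((hle t.1).trans ⟨fun h => exists_isInjCode t.2 hω0 h, ?_⟩)
    rintro ⟨e, he⟩
    exact he.card_le
  have hSle : #(S.1 : Set ZFSet.{u}) ≤ #((ω_ (1 : Ordinal.{u})).toZFSet : Set ZFSet.{u}) := by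
    rw [card_omega_coe]
    exact (Cardinal.mk_le_mk_of_subset fun t ht => (hS t).1 ht).trans (card_countable_subsets_le CH)
  obtain ⟨e, he, heK⟩ := exists_common_witness hr
    (p := fun v e => IsInjCode e.1 (v 0).1 (v 1).1) (IsDef.isInjCode _ _ _)
    ![S, ⟨_, hω1⟩] (exists_isInjCode S.2 hω1 hSle)
  have heK' : ∀ K, IsSub κ r K → e.1 ∈ K := fun K hK => heK K hK fun i => by
    fin_cases i
    exacts [hSmem K hK, hmem1 K hK]
  obtain ⟨m, hm, hmA⟩ := he.1 A ((hS A).2 ⟨hAω, hAc⟩)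
  have hmM : m ∈ M := hM.fst_mem_of_isInjCode he (heK' M hM) hA hmA
  obtain ⟨ν, hν, rfl⟩ := Ordinal.mem_toZFSet_iff.1 hm
  have hmL : ν.toZFSet ∈ L :=
    hL.mem_of_lt_height h1 ((hM.lt_height h1 hν hmM).trans_le hδ)
  exact hL.snd_mem_of_isInjCode he (heK' L hL) hmL hmA

end CH

/-! ### Chains of models -/

section Chains

variable {κ : Cardinal.{u}} {r : H κ → H κ → Prop}

theorem IsNModel.isSub {k : ℕ} {N : ZFSet.{u}} (hN : IsNModel κ r k N) : IsSub κ r N := by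
  cases k with
  | zero => exact hN
  | succ k => exact hN.1

variable [hκ : Fact κ.IsRegular]

theorem IsSub.natCast_lt_height {M : ZFSet.{u}} (hM : IsSub κ r M) (h1 : ℵ_ 1 < κ) (k : ℕ) :
    (k : Ordinal.{u}) < height M :=
  hM.lt_height h1 ((Ordinal.natCast_lt_omega0 k).trans Ordinal.omega0_lt_omega_one)
    (IsInductive.natCast_mem ⟨hM.empty_mem, fun _ ht => hM.insert_mem ht ht⟩ k)

theorem chain_mono {k : ℕ} {N : ZFSet.{u}} (h1 : ℵ_ 1 < κ) {C : Ordinal.{u} → ZFSet.{u}}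
    (hC : IsContinuousIncreasingChain (height N) C)
    (hCN : ∀ α < height N, C α ∈ N ∧ IsNModel κ r k (C α)) {α β : Ordinal.{u}} (hαβ : α ≤ β)
    (hβ : β < height N) : C α ⊆ C β := by
  rcases hαβ.eq_or_lt with rfl | hlt
  · exact fun _ h => h
  · exact (hCN β hβ).2.isSub.subset_of_countable h1 (hC.1 α β hlt hβ)
      (hCN α (hlt.trans hβ)).2.isSub.1

/-- A finite subset of the union of a chain is contained in all late members of the chain. -/
theorem exists_chain_subset {k : ℕ} {N : ZFSet.{u}} (h1 : ℵ_ 1 < κ) (hN : IsSub κ r N)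
    {C : Ordinal.{u} → ZFSet.{u}} (hC : IsContinuousIncreasingChain (height N) C)
    (hCN : ∀ α < height N, C α ∈ N ∧ IsNModel κ r k (C α))
    (hU : ∀ x, x ∈ N ↔ ∃ α < height N, x ∈ C α) {F : Set ZFSet.{u}} (hF : F.Finite)
    (hFN : ∀ x ∈ F, x ∈ N) :
    ∃ α₀ < height N, ∀ α, α₀ ≤ α → α < height N → ∀ x ∈ F, x ∈ C α := by
  induction F, hF using Set.Finite.induction_on with
  | empty => exact ⟨0, by simpa using hN.natCast_lt_height h1 0, by simp⟩
  | @insert a s _ _ ih =>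
    obtain ⟨α, hα, h⟩ := ih fun x hx => hFN x (Set.mem_insert_of_mem a hx)
    obtain ⟨β, hβ, haβ⟩ := (hU a).1 (hFN a (Set.mem_insert a s))
    refine ⟨max α β, max_lt hα hβ, fun γ hγ hγN x hx => ?_⟩
    rcases Set.mem_insert_iff.1 hx with rfl | hx
    · exact chain_mono h1 hC hCN ((le_max_right α β).trans hγ) hγN haβ
    · exact h γ ((le_max_left α β).trans hγ) hγN x hx

/-- The chain of a model has arbitrarily late members `C α` that contain, for each of finitely
many countable sets `A i` of ordinals, the strict supremum of `A i ∩ C α`. Indeed this supremum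
increases strictly along the indices `α` for which it is not in `C α`, so these indices embed
increasingly into an ordinal below `δ_N`. -/
theorem exists_ssup_mem_chain {k : ℕ} {N : ZFSet.{u}} (h1 : ℵ_ 1 < κ) (hN : IsSub κ r N)
    {C : Ordinal.{u} → ZFSet.{u}} (hC : IsContinuousIncreasingChain (height N) C)
    (hCN : ∀ α < height N, C α ∈ N ∧ IsNModel κ r k (C α))
    {l : ℕ} (hl : ℵ_ (l : Ordinal.{u}) < κ)
    {ι : Type v} [Finite ι] (A M : ι → ZFSet.{u}) (hM : ∀ i, IsSub κ r (M i))
    (hA : ∀ i, A i ∈ M i) (hAω : ∀ i, A i ⊆ (ω_ (l : Ordinal.{u})).toZFSet)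
    (hAc : ∀ i, (A i : Set ZFSet.{u}).Countable)
    {μ : Ordinal.{u}} (hμ : μ < height N) (hMμ : ∀ i, height (M i) ≤ μ)
    {α₀ : Ordinal.{u}} (hα₀ : α₀ < height N) :
    ∃ α, α₀ ≤ α ∧ α < height N ∧ ∀ i, ssup (A i ∩ C α) ∈ C α := by
  have hCs : ∀ α < height N, IsSub κ r (C α) := fun α hα => (hCN α hα).2.isSub
  have hAo : ∀ i, ∀ a ∈ A i, a.IsOrdinal := fun i a ha => isOrdinal_of_mem_toZFSet (hAω i ha)
  have hσo : ∀ i α, (ssup (A i ∩ C α)).IsOrdinal := fun i α =>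
    isOrdinal_ssup fun a ha => hAo i a (ZFSet.mem_inter.1 ha).1
  have hnext : ∀ i α β, α < β → β < height N → ssup (A i ∩ C α) ∈ C β := by
    intro i α β hαβ hβ
    have hω := (hCs β hβ).omega_mem l hl
    refine (hCs β hβ).ssup_mem_of_subset h1 (C := C α ∩ (ω_ (l : Ordinal.{u})).toZFSet)
      ((hCs β hβ).inter_mem (hC.1 α β hαβ hβ) hω) ?_
      (fun c hc => isOrdinal_of_mem_toZFSet (ZFSet.mem_inter.1 hc).2) fun z hz => ?_
    · rw [ZFSet.coe_inter]
      exact (hCs α (hαβ.trans hβ)).1.mono Set.inter_subset_left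
    · obtain ⟨hzA, hzC⟩ := ZFSet.mem_inter.1 hz
      exact ZFSet.mem_inter.2 ⟨hzC, hAω i hzA⟩
  choose f hfM hf using fun i => (hM i).exists_increasing h1 (hA i) (hAc i)
  -- The index `α` is sent to the value of `f i` at the least element of `A i` that is not below
  -- `ssup (A i ∩ C α)`, and to `μ`, which exceeds all values of `f i`, if there is none.
  let S : ι → Ordinal.{u} → Set Ordinal.{u} := fun i α =>
    insert μ (f i '' {a | a ∈ A i ∧ a ∉ ssup (A i ∩ C α)})
  have hSne : ∀ i α, (S i α).Nonempty := fun i α => ⟨μ, Set.mem_insert _ _⟩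
  have hprin := hN.isPrincipal_mul_height h1
  have h2 : 2 < height N := by exact_mod_cast hN.natCast_lt_height h1 2
  have hμ' : μ + 1 < height N :=
    Ordinal.isPrincipal_add_of_isPrincipal_mul hprin h2.ne' hμ
      (by exact_mod_cast hN.natCast_lt_height h1 1)
  have hmono : ∀ i, StrictMonoOn (fun α => sInf (S i α))
      {α | α < height N ∧ ssup (A i ∩ C α) ∉ C α} := by
    intro i α hα β hβ hαβ
    have hsub : ssup (A i ∩ C α) ⊆ ssup (A i ∩ C β) := ssup_mono fun z hz => by
      obtain ⟨hzA, hzC⟩ := ZFSet.mem_inter.1 hz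
      exact ZFSet.mem_inter.2 ⟨hzA, chain_mono h1 hC hCN hαβ.le hβ.1 hzC⟩
    have hmem : ssup (A i ∩ C α) ∈ ssup (A i ∩ C β) := by
      rcases ((hσo i α).subset_iff_eq_or_mem (hσo i β)).1 hsub with h | h
      · exact absurd (h ▸ hnext i α β hαβ hβ.1) hβ.2
      · exact h
    obtain ⟨a, ha, haσ⟩ := mem_ssup.1 hmem
    have haA := (ZFSet.mem_inter.1 ha).1
    have hnot : a ∉ ssup (A i ∩ C α) := by
      rcases haσ with h | h
      · rw [h]
        exact ZFSet.mem_irrefl a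
      · exact ZFSet.mem_asymm h
    have haS : f i a ∈ S i α := Or.inr ⟨a, ⟨haA, hnot⟩, rfl⟩
    refine (csInf_le' haS).trans_lt ?_
    rcases csInf_mem (hSne i β) with h | ⟨b, ⟨hb, hbσ⟩, h⟩
    · exact ((hfM i a haA).trans_le (hMμ i)).trans_eq h.symm
    · change f i a < sInf (S i β)
      rw [← h]
      exact hf i a haA b hb
        (((hAo i b hb).notMem_iff_subset (hσo i β)).1 hbσ (subset_ssup _ ha))
  obtain ⟨α, hα, hαN, hbad⟩ := exists_notMem_of_isPrincipal_mul hprin h2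
    (fun i => {α | α < height N ∧ ssup (A i ∩ C α) ∉ C α}) (fun _ => μ + 1) (fun _ => hμ')
    (fun i α => sInf (S i α)) hmono
    (fun i α _ => Order.lt_add_one_iff.2 (csInf_le' (Set.mem_insert _ _))) hα₀
  exact ⟨α, hα, hαN, fun i => by_contra fun hcon => hbad i ⟨hαN, hcon⟩⟩

end Chains

/-! ### Splitting countable sets along a submodel -/

section Core

variable {κ : Cardinal.{u}} {r : H κ → H κ → Prop} [hκ : Fact κ.IsRegular]

theorem IsSub.mem_of_image {K e γ D x : ZFSet.{u}} (hK : IsSub κ r K) (he : e ∈ K) (hγ : γ ∈ K)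
    (hD : D ∈ K) (hx : ∀ t, t ∈ x ↔ t ∈ γ ∧ ∃ m ∈ D, ZFSet.pair m t ∈ e) : x ∈ K := by
  refine hK.mem_of_forall_mem_iff (q := fun v t => t.1 ∈ (v 0).1 ∧
    ∃ m : H κ, m.1 ∈ (v 1).1 ∧ ZFSet.pair m.1 t.1 ∈ (v 2).1)
    ((IsDef.mem _ _).and (IsDef.ex ((IsDef.mem _ _).and (IsDef.pair_mem _ _ _))))
    ![⟨γ, hK.mem_H hγ⟩, ⟨D, hK.mem_H hD⟩, ⟨e, hK.mem_H he⟩]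
    (fun i => by
      fin_cases i
      exacts [hγ, hD, he]) _ (subset_mem_H (hK.mem_H hγ) fun t ht => ((hx t).1 ht).1) fun t => ?_
  rw [hx]
  refine and_congr Iff.rfl ⟨?_, ?_⟩
  · rintro ⟨m, hm, h⟩
    exact ⟨⟨m, mem_H_of_mem (hK.mem_H hD) hm⟩, hm, h⟩
  · rintro ⟨m, hm, h⟩
    exact ⟨m.1, hm, h⟩

theorem IsSub.mem_of_preimage {K e w γ A x : ZFSet.{u}} (hK : IsSub κ r K) (he : e ∈ K)
    (hw : w ∈ K) (hγ : γ ∈ K) (hA : A ∈ K)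
    (hx : ∀ t, t ∈ x ↔ t ∈ w ∧ ∃ a ∈ A, a ∈ γ ∧ ZFSet.pair t a ∈ e) : x ∈ K := by
  refine hK.mem_of_forall_mem_iff (q := fun v t => t.1 ∈ (v 0).1 ∧
    ∃ a : H κ, a.1 ∈ (v 1).1 ∧ a.1 ∈ (v 2).1 ∧ ZFSet.pair t.1 a.1 ∈ (v 3).1)
    ((IsDef.mem _ _).and (IsDef.ex ((IsDef.mem _ _).and
      ((IsDef.mem _ _).and (IsDef.pair_mem _ _ _)))))
    ![⟨w, hK.mem_H hw⟩, ⟨A, hK.mem_H hA⟩, ⟨γ, hK.mem_H hγ⟩, ⟨e, hK.mem_H he⟩]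
    (fun i => by
      fin_cases i
      exacts [hw, hA, hγ, he]) _ (subset_mem_H (hK.mem_H hw) fun t ht => ((hx t).1 ht).1)
    fun t => ?_
  rw [hx]
  refine and_congr Iff.rfl ⟨?_, ?_⟩
  · rintro ⟨a, ha, h⟩
    exact ⟨⟨a, mem_H_of_mem (hK.mem_H hA) ha⟩, ha, h⟩
  · rintro ⟨a, ha, h⟩
    exact ⟨a.1, ha, h⟩

/-- An ordinal `γ < ω_{k+1}` has an injection into `ω_k` that lies in all models containing `γ`. -/
theorem exists_common_isInjCode (hr : IsWellOrder (H κ) r) {k : ℕ}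
    (hk : ℵ_ ((k + 1 : ℕ) : Ordinal.{u}) < κ) {γ : ZFSet.{u}}
    (hγ : γ ∈ (ω_ ((k + 1 : ℕ) : Ordinal.{u})).toZFSet) :
    ∃ e, IsInjCode e γ (ω_ (k : Ordinal.{u})).toZFSet ∧ ∀ K, IsSub κ r K → γ ∈ K → e ∈ K := by
  have hk' : ℵ_ (k : Ordinal.{u}) < κ :=
    (Cardinal.aleph_le_aleph.2 (by exact_mod_cast Nat.le_succ k)).trans_lt hk
  have hγH : γ ∈ H κ := mem_H_of_mem (omega_mem_H hk) hγ
  have hωH : (ω_ (k : Ordinal.{u})).toZFSet ∈ H κ := omega_mem_H hk'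
  have hle : #(γ : Set ZFSet.{u}) ≤ #((ω_ (k : Ordinal.{u})).toZFSet : Set ZFSet.{u}) := by
    obtain ⟨β, hβ, rfl⟩ := Ordinal.mem_toZFSet_iff.1 hγ
    rw [card_omega_coe, card_toZFSet_coe, Cardinal.lift_le, ← Order.lt_succ_iff,
      Cardinal.succ_aleph, ← Cardinal.lt_ord, Cardinal.ord_aleph]
    exact_mod_cast hβ
  obtain ⟨e, he, heK⟩ := exists_common_witness hr
    (p := fun v e => IsInjCode e.1 (v 0).1 (v 1).1) (IsDef.isInjCode _ _ _)
    ![⟨γ, hγH⟩, ⟨_, hωH⟩] (exists_isInjCode hγH hωH hle)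
  exact ⟨e.1, he, fun K hK hγK => heK K hK fun i => by
    fin_cases i
    exacts [hγK, hK.omega_mem k hk']⟩

/-- If finitely many countable sets `A i ⊆ ω_{k+1}` lie in models `M i` lower than a
`(k+1)`-model `N`, then there is a model `L ∈ N` such that `A i ∩ L` belongs to both `M i` and
`L`. The induction on `k` replaces `A i` by its copy in `ω_k` under an injection of
`γ i = ssup (A i ∩ C α)`, for a member `C α` of the chain of `N` with `γ i ∈ C α`. -/
theorem exists_inter_mem (CH : (Cardinal.continuum.{u}) = ℵ_ 1) (hr : IsWellOrder (H κ) r)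
    {ι : Type v} [Finite ι] (M : ι → ZFSet.{u}) (hM : ∀ i, IsSub κ r (M i))
    {μ : Ordinal.{u}} (hMμ : ∀ i, height (M i) ≤ μ) (k : ℕ)
    (hk : ℵ_ ((k + 1 : ℕ) : Ordinal.{u}) < κ) (N : ZFSet.{u}) (hN : IsNModel κ r (k + 1) N)
    (hμ : μ < height N) (A : ι → ZFSet.{u}) (hA : ∀ i, A i ∈ M i)
    (hAω : ∀ i, A i ⊆ (ω_ ((k + 1 : ℕ) : Ordinal.{u})).toZFSet)
    (hAc : ∀ i, (A i : Set ZFSet.{u}).Countable) (F : Set ZFSet.{u}) (hF : F.Finite)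
    (hFN : ∀ x ∈ F, x ∈ N) :
    ∃ L ∈ N, IsSub κ r L ∧ (∀ x ∈ F, x ∈ L) ∧ μ < height L ∧
      ∀ i, A i ∩ L ∈ M i ∧ A i ∩ L ∈ L := by
  have h1 : ℵ_ 1 < κ := lt_of_le_of_lt (Cardinal.aleph_le_aleph.2 (by simp)) hk
  induction k generalizing N A F with
  | zero =>
    obtain ⟨hNs, C, hC, hCN, hU⟩ := hN
    obtain ⟨α, hα, hFα⟩ := exists_chain_subset h1 hNs hC hCN hU
      (hF.insert μ.toZFSet) (by
        rintro x (rfl | hx)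
        · exact hNs.mem_of_lt_height h1 hμ
        · exact hFN x hx)
    have hsub := (hCN α hα).2.isSub
    have hμα : μ < height (C α) := hsub.lt_height h1 (hμ.trans (hNs.height_lt h1))
      (hFα α le_rfl hα _ (Set.mem_insert _ _))
    refine ⟨C α, (hCN α hα).1, hsub, fun x hx => hFα α le_rfl hα x (Set.mem_insert_of_mem _ hx),
      hμα, fun i => ?_⟩
    have hAL : A i ∈ C α := (hM i).mem_of_subset_omega_one CH hr h1 hsub
      ((hMμ i).trans hμα.le) (hA i) (by simpa using hAω i) (hAc i)
    rw [ZFSet.inter_eq_left_of_subset (hsub.subset_of_countable h1 hAL (hAc i))]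
    exact ⟨hA i, hAL⟩
  | succ k ih =>
    obtain ⟨hNs, C, hC, hCN, hU⟩ := hN
    obtain ⟨α₀, hα₀, hFα⟩ := exists_chain_subset h1 hNs hC hCN hU
      (hF.insert μ.toZFSet) (by
        rintro x (rfl | hx)
        · exact hNs.mem_of_lt_height h1 hμ
        · exact hFN x hx)
    obtain ⟨α, hα₀α, hα, hγC⟩ := exists_ssup_mem_chain h1 hNs hC hCN hk A M hM hA hAω hAc hμ hMμ hα₀
    have hsub := (hCN α hα).2.isSub
    have hμα : μ < height (C α) := hsub.lt_height h1 (hμ.trans (hNs.height_lt h1))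
      (hFα α hα₀α hα _ (Set.mem_insert _ _))
    have hk' : ℵ_ ((k + 1 : ℕ) : Ordinal.{u}) < κ :=
      (Cardinal.aleph_le_aleph.2 (by exact_mod_cast Nat.le_succ (k + 1))).trans_lt hk
    let γ : ι → ZFSet.{u} := fun i => ssup (A i ∩ C α)
    have hγω : ∀ i, γ i ∈ (ω_ ((k + 1 + 1 : ℕ) : Ordinal.{u})).toZFSet := fun i => by
      refine ssup_mem_omega ?_ fun z hz => hAω i (ZFSet.mem_inter.1 hz).1
      rw [ZFSet.coe_inter]
      exact (hAc i).mono Set.inter_subset_left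
    have hγM : ∀ i, γ i ∈ M i := fun i => (hM i).ssup_mem_of_subset h1 (hA i) (hAc i)
      (fun a ha => isOrdinal_of_mem_toZFSet (hAω i ha)) fun z hz => (ZFSet.mem_inter.1 hz).1
    choose e he heK using fun i => exists_common_isInjCode hr hk (hγω i)
    let B : ι → ZFSet.{u} := fun i => ZFSet.sep (fun m => ∃ a ∈ A i, a ∈ γ i ∧ ZFSet.pair m a ∈ e i)
      (ω_ ((k + 1 : ℕ) : Ordinal.{u})).toZFSet
    have hB : ∀ i t, t ∈ B i ↔ t ∈ (ω_ ((k + 1 : ℕ) : Ordinal.{u})).toZFSet ∧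
        ∃ a ∈ A i, a ∈ γ i ∧ ZFSet.pair t a ∈ e i := fun i t => ZFSet.mem_sep
    have hBM : ∀ i, B i ∈ M i := fun i => (hM i).mem_of_preimage (heK i _ (hM i) (hγM i))
      ((hM i).omega_mem _ hk') (hγM i) (hA i) (hB i)
    have hBc : ∀ i, (B i : Set ZFSet.{u}).Countable := fun i => by
      choose! g hgA _ hge using fun t (ht : t ∈ B i) => ((hB i t).1 ht).2
      refine Set.MapsTo.countable_of_injOn (f := g) (t := A i) (fun t ht => hgA t ht) ?_ (hAc i)
      exact fun t ht s hs hts => ((he i).2 _ _ _ _ (hge t ht) (hge s hs)).2 hts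
    obtain ⟨L, hLC, hL, hFL, hμL, hBL⟩ := ih hk' (C α) (hCN α hα).2 hμα B hBM
      (fun i t ht => ((hB i t).1 ht).1) hBc (F ∪ Set.range γ) (hF.union (Set.finite_range γ)) (by
        rintro x (hx | ⟨i, rfl⟩)
        · exact hFα α hα₀α hα x (Set.mem_insert_of_mem _ hx)
        · exact hγC i)
    have hLsub : L ⊆ C α := hsub.subset_of_countable h1 hLC hL.1
    refine ⟨L, hNs.subset_of_countable h1 (hCN α hα).1 hsub.1 hLC, hL,
      fun x hx => hFL x (Or.inl hx), hμL, fun i => ?_⟩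
    have hγL : γ i ∈ L := hFL _ (Or.inr ⟨i, rfl⟩)
    have heL := heK i L hL hγL
    have hAL : ∀ t, t ∈ A i ∩ L ↔ t ∈ γ i ∧ ∃ m ∈ B i ∩ L, ZFSet.pair m t ∈ e i := by
      intro t
      rw [ZFSet.mem_inter]
      constructor
      · rintro ⟨htA, htL⟩
        have htγ : t ∈ γ i := subset_ssup _ (ZFSet.mem_inter.2 ⟨htA, hLsub htL⟩)
        obtain ⟨m, hm, hmt⟩ := (he i).1 t htγ
        exact ⟨htγ, m, ZFSet.mem_inter.2 ⟨(hB i m).2 ⟨hm, t, htA, htγ, hmt⟩,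
          hL.fst_mem_of_isInjCode (he i) heL htL hmt⟩, hmt⟩
      · rintro ⟨-, m, hm, hmt⟩
        obtain ⟨hmB, hmL⟩ := ZFSet.mem_inter.1 hm
        obtain ⟨-, a, haA, -, hma⟩ := (hB i m).1 hmB
        obtain rfl := ((he i).2 _ _ _ _ hma hmt).1 rfl
        exact ⟨haA, hL.snd_mem_of_isInjCode (he i) heL hmL hmt⟩
    exact ⟨(hM i).mem_of_image (heK i _ (hM i) (hγM i)) (hγM i) (hBL i).1 hAL,
      hL.mem_of_image heL hγL (hBL i).2 hAL⟩

end Core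

end SubmodelComb

theorem mainTheorem6
    (CH : (Cardinal.continuum.{u}) = Cardinal.aleph 1)
    (l n : ℕ) (hl : 0 < l)
    (κ : Cardinal.{u}) (hκ : κ.IsRegular) (hlκ : Cardinal.aleph (l : Ordinal.{u}) < κ)
    (r : SubmodelComb.H κ → SubmodelComb.H κ → Prop) (hr : IsWellOrder (SubmodelComb.H κ) r)
    (M P : Fin (n + 1) → ZFSet.{u})
    (hM : SubmodelComb.IsDeltaIncreasing κ r M)
    (hP : SubmodelComb.IsDecisivePartition l M P)
    (N : ZFSet.{u}) (hN : SubmodelComb.IsNModel κ r l N)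
    (hδ : SubmodelComb.height (M (Fin.last n)) < SubmodelComb.height N)
    (X : ZFSet.{u}) (hX : X ∈ N) :
    ∃ L ∈ N, ∃ R : Fin (n + 1) → ZFSet.{u},
      (SubmodelComb.IsSub κ r L ∧
        SubmodelComb.height (M (Fin.last n)) < SubmodelComb.height L ∧ X ∈ L) ∧
      SubmodelComb.IsDecisivePartition l M R ∧
      (∀ i, SubmodelComb.TwoRefines (R i) (P i)) ∧
      ∀ i, ∀ A ∈ R i, A ∈ L ∨ A ∩ L = ∅ := by
  open SubmodelComb in
  obtain ⟨k, rfl⟩ : ∃ k, l = k + 1 := ⟨l - 1, by omega⟩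
  have : Fact κ.IsRegular := ⟨hκ⟩
  obtain ⟨hP1, hP2⟩ := hP
  have hmono : Monotone fun i => height (M i) := Fin.monotone_iff_le_succ.2 hM.2
  -- The index set: all pairs of `i ≤ n` and `A ∈ P i`.
  let ι := Σ i, {A : ZFSet.{u} // A ∈ (P i : Set ZFSet.{u})}
  have : ∀ i, Finite {A : ZFSet.{u} // A ∈ (P i : Set ZFSet.{u})} := fun i => (hP1 i).2.2.1
  have hPM : ∀ i, ∀ A ∈ P i, A ∈ M i := fun i A hA =>
    (hM.1 i).subset_of_countable
      (lt_of_le_of_lt (Cardinal.aleph_le_aleph.2 (by simp)) hlκ) (hP1 i).1 (hP1 i).2.2.1.countable hA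
  obtain ⟨L, hLN, hL, hXL, hδL, hAL⟩ := exists_inter_mem (ι := ι) CH hr (fun p => M p.1)
    (fun p => hM.1 p.1) (fun p => hmono (Fin.le_last p.1)) k hlκ N hN hδ (fun p => p.2.1)
    (fun p => hPM p.1 _ p.2.2) (fun p => ((hP1 p.1).2.2.2 _ p.2.2).1)
    (fun p => ((hP1 p.1).2.2.2 _ p.2.2).2) {X} (Set.finite_singleton X) (by simpa using hX)
  have hAL1 : ∀ i, ∀ A ∈ P i, A ∩ L ∈ M i := fun i A hA => (hAL ⟨i, A, hA⟩).1
  have hAL2 : ∀ i, ∀ A ∈ P i, A ∩ L ∈ L := fun i A hA => (hAL ⟨i, A, hA⟩).2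
  have hAd : ∀ i, ∀ A ∈ P i, A \ L ∈ M i := fun i A hA => by
    have : A \ L = A \ (A ∩ L) := by
      ext z
      simp only [ZFSet.mem_sdiff, ZFSet.mem_inter]
      tauto
    rw [this]
    exact (hM.1 i).sdiff_mem (hPM i A hA) (hAL1 i A hA)
  have hfin : ∀ i, ((fun A => A ∩ L) '' (P i : Set ZFSet.{u}) ∪
      (fun A => A \ L) '' (P i : Set ZFSet.{u})).Finite := fun i =>
    ((hP1 i).2.2.1.image _).union ((hP1 i).2.2.1.image _)
  choose R hR using fun i => exists_H_eq (κ := κ) (s := (fun A => A ∩ L) '' (P i : Set ZFSet.{u}) ∪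
      (fun A => A \ L) '' (P i : Set ZFSet.{u})) (by
    rintro _ (⟨A, hA, rfl⟩ | ⟨A, hA, rfl⟩)
    · exact (hM.1 i).mem_H (hAL1 i A hA)
    · exact (hM.1 i).mem_H (hAd i A hA)) (finite_card_lt (hfin i))
  have hR' : ∀ i x, x ∈ (R i).1 ↔ ∃ A ∈ P i, x = A ∩ L ∨ x = A \ L := by
    intro i x
    rw [hR]
    constructor
    · rintro (⟨A, hA, rfl⟩ | ⟨A, hA, rfl⟩)
      exacts [⟨A, hA, Or.inl rfl⟩, ⟨A, hA, Or.inr rfl⟩]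
    · rintro ⟨A, hA, rfl | rfl⟩
      exacts [Or.inl ⟨A, hA, rfl⟩, Or.inr ⟨A, hA, rfl⟩]
  have hsub : ∀ x A : ZFSet.{u}, x = A ∩ L ∨ x = A \ L → x ⊆ A := by
    rintro x A (rfl | rfl) z hz
    · exact (ZFSet.mem_inter.1 hz).1
    · exact (ZFSet.mem_sdiff.1 hz).1
  have hunion : ∀ i, ∀ A ∈ P i, ∃ S, S ⊆ (R i).1 ∧ (S : Set ZFSet.{u}).encard ≤ 2 ∧
      A = ZFSet.sUnion S := by
    intro i A hA
    refine ⟨{A ∩ L, A \ L}, fun x hx => (hR' i x).2 ⟨A, hA, ZFSet.mem_pair.1 hx⟩, ?_, ?_⟩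
    · rw [ZFSet.coe_insert, ZFSet.coe_singleton]
      exact (Set.encard_insert_le _ _).trans (by rw [Set.encard_singleton]; norm_num)
    · ext z
      simp only [ZFSet.sUnion_pair, ZFSet.mem_union, ZFSet.mem_inter, ZFSet.mem_sdiff]
      tauto
  refine ⟨L, hLN, fun i => (R i).1, ⟨hL, hδL, hXL X rfl⟩, ⟨fun i => ⟨?_, ?_, ?_, ?_⟩, ?_⟩,
    fun i => ⟨⟨?_, ?_⟩, hunion i⟩, ?_⟩
  · refine (hM.1 i).mem_of_finite ((hfin i).subset fun x hx => (hR i x).1 hx) fun x hx => ?_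
    obtain ⟨A, hA, rfl | rfl⟩ := (hR' i x).1 hx
    exacts [hAL1 i A hA, hAd i A hA]
  · intro x hx y hy hxy
    obtain ⟨A, hA, hxA⟩ := (hR' i x).1 hx
    obtain ⟨B, hB, hyB⟩ := (hR' i y).1 hy
    rw [ZFSet.eq_empty]
    intro z hz
    obtain ⟨hzx, hzy⟩ := ZFSet.mem_inter.1 hz
    by_cases hAB : A = B
    · subst hAB
      rcases hxA with rfl | rfl <;> rcases hyB with rfl | rfl <;> simp_all
    · have h := (hP1 i).2.1 A hA B hB hAB
      exact ZFSet.notMem_empty z (h ▸ ZFSet.mem_inter.2 ⟨hsub x A hxA hzx, hsub y B hyB hzy⟩)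
  · exact (hfin i).subset fun x hx => (hR i x).1 hx
  · intro x hx
    obtain ⟨A, hA, hxA⟩ := (hR' i x).1 hx
    have h := (hP1 i).2.2.2 A hA
    exact ⟨fun z hz => h.1 (hsub x A hxA hz), h.2.mono fun z hz => hsub x A hxA hz⟩
  · intro i j hij x hx
    obtain ⟨A, hA, hxA⟩ := (hR' i x).1 hx
    rcases hP2 i j hij A hA with h | h
    · exact Or.inl ((hR' j x).2 ⟨A, h, hxA⟩)
    · refine Or.inr ((ZFSet.eq_empty _).2 fun z hz => ?_)
      obtain ⟨hzx, hzM⟩ := ZFSet.mem_inter.1 hz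
      exact ZFSet.notMem_empty z (h ▸ ZFSet.mem_inter.2 ⟨hsub x A hxA hzx, hzM⟩)
  · intro x hx
    obtain ⟨A, hA, hxA⟩ := (hR' i x).1 hx
    exact ⟨A, hA, hsub x A hxA⟩
  · intro A hA
    obtain ⟨S, hS, -, hSA⟩ := hunion i A hA
    exact ⟨S, hS, hSA⟩
  · intro i x hx
    obtain ⟨A, hA, rfl | rfl⟩ := (hR' i x).1 hx
    · exact Or.inl (hAL2 i A hA)
    · refine Or.inr ((ZFSet.eq_empty _).2 fun z hz => ?_)
      obtain ⟨hz1, hz2⟩ := ZFSet.mem_inter.1 hz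
      exact (ZFSet.mem_sdiff.1 hz1).2 hz2
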